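/- Let $R$ be an associative ring with $1$ equipped with a pseudo-involution, i.e. an additive map $a\mapsto\bar a$ with $\bar 1$ invertible, $\overline{\bar a}=a$ and $\overline{ab}=\bar b\,\bar1^{-1}\bar a$. Let $V$ be a right $R$-module with an anti-Hermitian form $B$, i.e. a biadditive map $B:V\times V\to R$ with $B(ua,vb)=\bar a\,\bar1^{-1}B(u,v)b$ and $B(u,v)=-\overline{B(v,u)}$. Let $\mathfrak H=V\times R$ be its Heisenberg group, with $(u,a)\dotplus(v,b)=(u+v,\,a+b+B(u,v))$, and put $(u,a)\leftharpoonup b=(ub,\ \bar b\,\bar1^{-1}ab)$. Let $\mathfrak L$ be an odd form parameter: a subgroup of $\mathfrak H$, stable under $\leftharpoonup$, with $\{(0,a+\bar a)\mid a\in R\}\subseteq\mathfrak L\subseteq\{(u,a)\mid a=\bar a+B(u,u)\}$. Let $\Omega=\{1,\dots,4,-4,\dots,-1\}$, $\varepsilon_i=\bar1^{-1}$ for $i>0$ and $\varepsilon_i=-1$ for $i<0$, and $[x,y]=xyx^{-1}y^{-1}$. The odd unitary Steinberg group $\mathrm{StU}(8,R,\mathfrak L)$ is the group with generators $X_{ij}(a)$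 ($i,j\in\Omega$, $i\notin\{\pm j\}$, $a\in R$) and $X_i(\xi)$ ($i\in\Omega$, $\xi\in\mathfrak L$), and with the following relations, imposed whenever all the symbols $X_{pq}(\cdot)$ occurring satisfy $p\notin\{\pm q\}$: - $X_{ij}(a)=X_{-j,-i}(\varepsilon_{-j}\bar a\varepsilon_i)$; - $X_{ij}(a)X_{ij}(b)=X_{ij}(a+b)$; - $X_i(\xi)X_i(\zeta)=X_i(\xi\dotplus\zeta)$; - $[X_{ij}(a),X_{hk}(b)]=1$ for $h\notin\{j,-i\}$, $k\notin\{i,-j\}$; - $[X_i(\xi),X_{jk}(a)]=1$ for $j\ne-i$, $k\ne i$; - $[X_{ij}(a),X_{jk}(b)]=X_{ik}(ab)$; - $[X_i(u,a),X_j(v,b)]=X_{i,-j}(\varepsilon_iB(u,v))$ for $i\notin\{\pm j\}$; - $[X_i(u,a),X_i(v,b)]=X_i(0,\,B(u,v)-B(v,u))$; - $[X_i(u,a),X_{-i,j}(b)]=X_{ij}(\varepsilon_iab)\,X_{-j}((u,-\bar a)\leftharpoonup b)$; - $[X_{ij}(a),X_{j,-i}(b)]=X_i(0,\,-\varepsilon_{-i}\bar1ab+\bar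 b\,\bar1^{-1}\bar a\varepsilon_i)$. A central extension of a group $G$ is an epimorphism $\epsilon:H\to G$ whose kernel lies in the center of $H$; a central extension $\pi:U\to G$ is universal if for every central extension $\epsilon:H\to G$ there is exactly one homomorphism $\eta:U\to H$ with $\epsilon\eta=\pi$. In that case the Schur multiplier $\mathrm M(G)$ is by definition $\ker\pi$. **Theorem.** Let $\pi:U\to\mathrm{StU}(8,R,\mathfrak L)$ be a universal central extension. Then the Schur multiplier $\mathrm M(\mathrm{StU}(8,R,\mathfrak L))=\ker\pi$ coincides with the subgroup of $U$ generated by all commutators $[x,y]$, where $x,y\in U$ are such that $\pi(x)=X_{ij}(a)$ and $\pi(y)=X_{kh}(b)$ for some $a,b\in R$ and some $i,j,k,h\in\Omega$ for which $\pm i,\pm j,\pm k,\pm h$ are eight distinct indices. -/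

import Mathlib

universe u v w

open scoped commutatorElement

/-! ### Central extensions -/

/-- `ε : H →* G` is a central extension of `G`: an epimorphism with central kernel. -/
structure IsCentralExtension {H : Type*} {G : Type*} [Group H] [Group G] (ε : H →* G) : Prop where
  surjective : Function.Surjective ε
  ker_le_center : ε.ker ≤ Subgroup.center H

/-- `π : U →* G` is a universal central extension of `G`: for every central extension
`ε : H →* G` there is exactly one homomorphism `η : U →* H` over `G`.  The test groups `H` range
over the universe of `U`; as `U` maps onto `G`, that universe contains (up to isomorphism)
`G` and all quotients of subgroups of free groups on `G`, so that a larger universe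
of test groups gives the same notion. -/
structure IsUniversalCentralExtension {U : Type w} {G : Type*} [Group U] [Group G]
    (π : U →* G) : Prop extends IsCentralExtension π where
  existsUnique_lift : ∀ (H : Type w) [Group H] (ε : H →* G), IsCentralExtension ε →
    ∃! η : U →* H, ε.comp η = π

/-- The Schur multiplier `M(G)`, as the kernel of a universal central extension `π : U →* G`. -/
def schurMultiplier {U : Type w} {G : Type*} [Group U] [Group G]
    (π : U →* G) (_hπ : IsUniversalCentralExtension π) : Subgroup U :=
  π.ker

/-! ### Rings with pseudo-involution, forms, odd form parameters -/

/-- A pseudo-involution on an associative ring `R` with identity. -/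
structure PseudoInvolution (R : Type u) [Ring R] where
  /-- the additive map `a ↦ ā` -/
  bar : R →+ R
  isUnit_bar_one : IsUnit (bar 1)
  bar_bar : ∀ a, bar (bar a) = a
  bar_mul : ∀ a b, bar (a * b) = bar b * Ring.inverse (bar 1) * bar a

/-- The element `(1̄)⁻¹`. -/
noncomputable def PseudoInvolution.lamInv {R : Type u} [Ring R] (J : PseudoInvolution R) : R :=
  Ring.inverse (J.bar 1)

/-- An anti-Hermitian form on a right `R`-module `V` (right `R`-modules are modules over
`Rᵐᵒᵖ`, and `u a` is `MulOpposite.op a • u`). -/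
structure AntiHermitianForm {R : Type u} [Ring R] (J : PseudoInvolution R)
    (V : Type v) [AddCommGroup V] [Module Rᵐᵒᵖ V] where
  /-- the underlying biadditive map -/
  form : V →+ V →+ R
  form_smul_smul : ∀ (x y : V) (a b : R),
    form (MulOpposite.op a • x) (MulOpposite.op b • y) = J.bar a * J.lamInv * form x y * b
  form_swap : ∀ x y : V, form x y = -J.bar (form y x)

section Heisenberg

variable {R : Type u} [Ring R] {J : PseudoInvolution R}
  {V : Type v} [AddCommGroup V] [Module Rᵐᵒᵖ V]

/-- The underlying set `V × R` of the Heisenberg group of `B`. -/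
@[ext]
structure Heisenberg (B : AntiHermitianForm J V) where
  /-- the component in `V` -/
  vec : V
  /-- the component in `R` -/
  scal : R

namespace Heisenberg

variable {B : AntiHermitianForm J V}

/-- `(x, a) ∔ (y, b) = (x + y, a + b + B(x, y))`. -/
instance : Add (Heisenberg B) :=
  ⟨fun p q => ⟨p.vec + q.vec, p.scal + q.scal + B.form p.vec q.vec⟩⟩

instance : Zero (Heisenberg B) := ⟨⟨0, 0⟩⟩

/-- `∸(x, a) = (-x, -a + B(x, x))`. -/
instance : Neg (Heisenberg B) := ⟨fun p => ⟨-p.vec, -p.scal + B.form p.vec p.vec⟩⟩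

@[simp] theorem vec_add (p q : Heisenberg B) : (p + q).vec = p.vec + q.vec := rfl
@[simp] theorem scal_add (p q : Heisenberg B) :
    (p + q).scal = p.scal + q.scal + B.form p.vec q.vec := rfl
@[simp] theorem vec_zero : (0 : Heisenberg B).vec = 0 := rfl
@[simp] theorem scal_zero : (0 : Heisenberg B).scal = 0 := rfl
@[simp] theorem vec_neg (p : Heisenberg B) : (-p).vec = -p.vec := rfl
@[simp] theorem scal_neg (p : Heisenberg B) : (-p).scal = -p.scal + B.form p.vec p.vec := rfl

/-- The Heisenberg group, written additively (it need not be commutative). -/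
instance : AddGroup (Heisenberg B) :=
  AddGroup.ofLeftAxioms
    (fun p q r => by
      ext
      · simp [add_assoc]
      · simp only [scal_add, vec_add, map_add, AddMonoidHom.add_apply]
        abel)
    (fun p => by ext <;> simp)
    (fun p => by ext <;> simp)

/-- The right action `(x, a) ↼ b = (x b, b̄ 1̄⁻¹ a b)` of `R`. -/
noncomputable def act (p : Heisenberg B) (b : R) : Heisenberg B :=
  ⟨MulOpposite.op b • p.vec, J.bar b * J.lamInv * p.scal * b⟩

end Heisenberg

/-- The minimal odd form parameter. -/
def minFormParameter (B : AntiHermitianForm J V) : Set (Heisenberg B) :=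
  {p | ∃ a : R, p = ⟨0, a + J.bar a⟩}

/-- The maximal odd form parameter. -/
def maxFormParameter (B : AntiHermitianForm J V) : Set (Heisenberg B) :=
  {p | p.scal = J.bar p.scal + B.form p.vec p.vec}

/-- An odd form parameter: a subgroup of the Heisenberg group between the minimal and the maximal
one, stable under the action of `R`. -/
structure OddFormParameter (B : AntiHermitianForm J V) extends AddSubgroup (Heisenberg B) where
  min_le : minFormParameter B ⊆ carrier
  le_max : carrier ⊆ maxFormParameter B
  act_mem : ∀ p ∈ carrier, ∀ b : R, p.act b ∈ carrier

namespace OddFormParameter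

variable {B : AntiHermitianForm J V} (L : OddFormParameter B)

theorem neg_bar_mem {p : Heisenberg B} (hp : p ∈ L.toAddSubgroup) :
    (⟨p.vec, -J.bar p.scal⟩ : Heisenberg B) ∈ L.toAddSubgroup := by
  have h1 : (-p).act (-1) ∈ L.toAddSubgroup := L.act_mem _ (L.neg_mem hp) (-1)
  have h2 : p.scal = J.bar p.scal + B.form p.vec p.vec := L.le_max hp
  have h3 : -p.scal + B.form p.vec p.vec = -J.bar p.scal := by
    nth_rewrite 1 [h2]
    abel
  have h4 : J.bar 1 * J.lamInv = 1 := Ring.mul_inverse_cancel _ J.isUnit_bar_one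
  have h5 : (-p).act (-1) = ⟨p.vec, -J.bar p.scal⟩ := by
    ext
    · simp [Heisenberg.act]
    · simp only [Heisenberg.act, Heisenberg.scal_neg, h3, map_neg, neg_mul, h4]
      simp
  rwa [h5] at h1

theorem form_sub_form_mem (x y : V) :
    (⟨0, B.form x y - B.form y x⟩ : Heisenberg B) ∈ L.toAddSubgroup := by
  refine L.min_le ⟨B.form x y, ?_⟩
  rw [B.form_swap y x, sub_neg_eq_add]

end OddFormParameter

end Heisenberg

/-! ### The odd unitary Steinberg group -/

/-- The index set `Ω = {1, …, n, -n, …, -1}`: the pair `(k, true)` stands for the index `k + 1`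
and the pair `(k, false)` for the index `-(k + 1)`. -/
def SignedIndex (n : ℕ) : Type := Fin n × Bool

namespace SignedIndex

variable {n : ℕ}

instance : DecidableEq (SignedIndex n) := inferInstanceAs (DecidableEq (Fin n × Bool))

instance : Fintype (SignedIndex n) := inferInstanceAs (Fintype (Fin n × Bool))

instance : InvolutiveNeg (SignedIndex n) where
  neg i := (i.1, !i.2)
  neg_neg i := Prod.ext rfl (Bool.not_not i.2)

/-- `i ∉ {±j}`. -/
def Apart (i j : SignedIndex n) : Prop := i ≠ j ∧ i ≠ -j

theorem Apart.symm {i j : SignedIndex n} (h : Apart i j) : Apart j i :=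
  ⟨h.1.symm, fun e => h.2 (by rw [e, neg_neg])⟩

theorem Apart.neg_right {i j : SignedIndex n} (h : Apart i j) : Apart i (-j) :=
  ⟨h.2, by rw [neg_neg]; exact h.1⟩

theorem Apart.neg_left {i j : SignedIndex n} (h : Apart i j) : Apart (-i) j :=
  h.symm.neg_right.symm

/-- `ε_i = 1̄⁻¹` for positive `i` and `ε_i = -1` for negative `i`. -/
noncomputable def eps {R : Type u} [Ring R] (J : PseudoInvolution R) (i : SignedIndex n) : R :=
  if i.2 = true then J.lamInv else -1

theorem eps_cases {R : Type u} [Ring R] (J : PseudoInvolution R) (i : SignedIndex n) :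
    eps J i = J.lamInv ∧ eps J (-i) = -1 ∨ eps J i = -1 ∧ eps J (-i) = J.lamInv := by
  have hneg : (-i).2 = !i.2 := rfl
  unfold eps
  rw [hneg]
  cases i.2 <;> simp

end SignedIndex

section Steinberg

open SignedIndex

variable {R : Type u} [Ring R] {J : PseudoInvolution R}
  {V : Type v} [AddCommGroup V] [Module Rᵐᵒᵖ V] {B : AntiHermitianForm J V}

theorem OddFormParameter.long_mem (L : OddFormParameter B) {n : ℕ} (i : SignedIndex n) (a b : R) :
    (⟨0, -(eps J (-i) * J.bar 1 * a * b) + J.bar b * J.lamInv * J.bar a * eps J i⟩ :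
      Heisenberg B) ∈ L.toAddSubgroup := by
  have h1 : J.lamInv * J.bar 1 = 1 := Ring.inverse_mul_cancel _ J.isUnit_bar_one
  have hm : ∀ x y, J.bar (x * y) = J.bar y * J.lamInv * J.bar x := J.bar_mul
  have he : J.bar b * J.lamInv * J.bar a * eps J i =
      J.bar (-(eps J (-i) * J.bar 1 * a * b)) := by
    rcases eps_cases J i with ⟨e1, e2⟩ | ⟨e1, e2⟩
    · rw [e1, e2]
      simp only [neg_mul, one_mul, neg_neg]
      rw [hm, hm, J.bar_bar, mul_one]
      simp only [mul_assoc]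
    · rw [e1, e2, h1, one_mul, map_neg, hm, mul_neg_one]
  exact L.min_le ⟨-(eps J (-i) * J.bar 1 * a * b), by rw [he]⟩

/-- The generators of the odd unitary Steinberg group. -/
inductive StUGen (n : ℕ) (L : OddFormParameter B) : Type (max u v)
  /-- the symbol `X_{ij}(a)`, for `i ∉ {±j}` -/
  | root (i j : SignedIndex n) (h : Apart i j) (a : R) : StUGen n L
  /-- the symbol `X_i(ξ)` -/
  | short (i : SignedIndex n) (ξ : L.toAddSubgroup) : StUGen n L

namespace StUGen

variable {n : ℕ} {L : OddFormParameter B}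

/-- `X_{ij}(a)` in the free group on the generators. -/
def Y (L : OddFormParameter B) (i j : SignedIndex n) (h : Apart i j) (a : R) :
    FreeGroup (StUGen n L) :=
  FreeGroup.of (root i j h a)

/-- `X_i(ξ)` in the free group on the generators. -/
def Z (i : SignedIndex n) (ξ : L.toAddSubgroup) : FreeGroup (StUGen n L) :=
  FreeGroup.of (short i ξ)

/-- `Rel L p q` says that `p = q` is one of the defining relations of the odd unitary Steinberg
group.  The commutator is `⁅x, y⁆ = x y x⁻¹ y⁻¹`. -/
inductive Rel (L : OddFormParameter B) :
    FreeGroup (StUGen n L) → FreeGroup (StUGen n L) → Prop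
  | r0 (i j : SignedIndex n) (h : Apart i j) (a : R) :
      Rel L (Y L i j h a)
        (Y L (-j) (-i) h.symm.neg_left.neg_right (eps J (-j) * J.bar a * eps J i))
  | r1 (i j : SignedIndex n) (h : Apart i j) (a b : R) :
      Rel L (Y L i j h a * Y L i j h b) (Y L i j h (a + b))
  | r2 (i : SignedIndex n) (ξ ζ : L.toAddSubgroup) :
      Rel L (Z i ξ * Z i ζ) (Z i (ξ + ζ))
  | r3 (i j h k : SignedIndex n) (hij : Apart i j) (hhk : Apart h k)
      (h1 : h ≠ j) (h2 : h ≠ -i) (h3 : k ≠ i) (h4 : k ≠ -j) (a b : R) :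
      Rel L ⁅Y L i j hij a, Y L h k hhk b⁆ 1
  | r4 (i j k : SignedIndex n) (hjk : Apart j k) (h1 : j ≠ -i) (h2 : k ≠ i)
      (ξ : L.toAddSubgroup) (a : R) :
      Rel L ⁅Z i ξ, Y L j k hjk a⁆ 1
  | r5 (i j k : SignedIndex n) (hij : Apart i j) (hjk : Apart j k) (hik : Apart i k) (a b : R) :
      Rel L ⁅Y L i j hij a, Y L j k hjk b⁆ (Y L i k hik (a * b))
  | r6 (i j : SignedIndex n) (h : Apart i j) (ξ ζ : L.toAddSubgroup) :
      Rel L ⁅Z i ξ, Z j ζ⁆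
        (Y L i (-j) h.neg_right (eps J i * B.form ξ.1.vec ζ.1.vec))
  | r7 (i : SignedIndex n) (ξ ζ : L.toAddSubgroup) :
      Rel L ⁅Z i ξ, Z i ζ⁆
        (Z i ⟨⟨0, B.form ξ.1.vec ζ.1.vec - B.form ζ.1.vec ξ.1.vec⟩,
          L.form_sub_form_mem ξ.1.vec ζ.1.vec⟩)
  | r8 (i j : SignedIndex n) (h : Apart i j) (ξ : L.toAddSubgroup) (b : R) :
      Rel L ⁅Z i ξ, Y L (-i) j h.neg_left b⁆
        (Y L i j h (eps J i * ξ.1.scal * b) *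
          Z (-j) ⟨Heisenberg.act ⟨ξ.1.vec, -J.bar ξ.1.scal⟩ b,
            L.act_mem _ (L.neg_bar_mem ξ.2) b⟩)
  | r9 (i j : SignedIndex n) (h : Apart i j) (a b : R) :
      Rel L ⁅Y L i j h a, Y L j (-i) h.symm.neg_right b⁆
        (Z i ⟨⟨0, -(eps J (-i) * J.bar 1 * a * b) + J.bar b * J.lamInv * J.bar a * eps J i⟩,
          L.long_mem i a b⟩)

end StUGen

/-- The odd unitary Steinberg group `StU(2n, R, 𝔏)`. -/
abbrev StU (n : ℕ) (L : OddFormParameter B) : Type (max u v) :=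
  PresentedGroup {r : FreeGroup (StUGen n L) | ∃ p q, StUGen.Rel L p q ∧ r = p * q⁻¹}

/-- The element `X_{ij}(a)` of `StU(2n, R, 𝔏)`. -/
def StU.X {n : ℕ} (L : OddFormParameter B) (i j : SignedIndex n) (h : Apart i j) (a : R) :
    StU n L :=
  PresentedGroup.of (StUGen.root i j h a)

end Steinberg

/-! ### Commutators in groups and central extensions -/

section Group

variable {H : Type*} [Group H]

/-! Let `C` be the subgroup generated by the listed commutators. The defining relations put it
inside `π.ker`, so it is central and `U ⧸ C` is still a central extension of `StU 4 L`. It is enough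
to split this quotient. `U` is perfect, and in a central extension commutators depend only on the
images of their entries, so every element of `U ⧸ C` lies in the image of the splitting. Hence the
kernel over `StU 4 L` is trivial, and `π.ker ≤ C`.

The splitting is `exists_section`: each generator gets a preimage defined as a commutator through an
auxiliary index, and these preimages are shown to satisfy all the Steinberg relations. Commutation
of two root elements lifts by writing one of them as a commutator through an index unrelated to all
those involved. With four index pairs this fails only when the two roots use all four, and there
`ApartRootsCommute` is the missing hypothesis; in `U ⧸ C` it holds by construction.

The remaining point is independence of the auxiliary index. For roots it follows from a Hall–Witt
identity (`commutator_section_assoc`). For short elements the same identity leaves a correction term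
(`shortLiftVia_transfer`), but that term does not involve the index being replaced, so it cancels.
Long elements are tied to commutators of roots by computing one double commutator in two ways
(`shortLift_long`). -/

theorem semiconjBy_commutatorElement (x y : H) : SemiconjBy x y (⁅x, y⁆ * y) := by
  simp [SemiconjBy, commutatorElement_def]

theorem SemiconjBy.commutatorElement_eq {x y c : H} (h : SemiconjBy x y (c * y)) : ⁅x, y⁆ = c := by
  rw [commutatorElement_def, h.eq]
  group

/-- A form of the Hall–Witt identity for `x` and `z` commuting. -/
theorem semiconjBy_commutator_commutator {x y z : H} (hxz : Commute x z)
    (hy : Commute ⁅y, z⁆ y) (hz : Commute ⁅y, z⁆ z) :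
    SemiconjBy (z * ⁅x, y⁆ * y) ⁅x, ⁅y, z⁆⁆ ⁅⁅x, y⁆, z⁆ := by
  have hw : ⁅y, z⁆ * z * y = y * z := by rw [commutatorElement_def]; group
  generalize ⁅y, z⁆ = w at *
  -- Since `w` commutes with `y`, the relation `w z y = y z` determines the conjugate of `z` by
  -- `y⁻¹`.
  have e1 : y⁻¹ * z * y = w⁻¹ * z := by
    have h : y * (w⁻¹ * z) = z * y := by
      rw [← mul_assoc, ← hy.inv_left.eq, mul_assoc, ← hw]; group
    rw [mul_assoc, ← h]; group
  calc z * ⁅x, y⁆ * y * ⁅x, w⁆ = (z * x) * y * w * x⁻¹ * w⁻¹ := by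
        simp only [commutatorElement_def]; group
    _ = x * (z * (y * w)) * x⁻¹ * w⁻¹ := by rw [← hxz.eq]; group
    _ = x * (w * z * y) * x⁻¹ * w⁻¹ := by rw [← hy.eq, ← mul_assoc z, ← hz.eq]
    _ = x * y * (z * x⁻¹) * w⁻¹ := by rw [hw]; group
    _ = x * y * x⁻¹ * (z * w⁻¹) := by rw [← hxz.inv_left.eq]; group
    _ = x * y * x⁻¹ * (y⁻¹ * z * y) := by rw [← hz.inv_left.eq, e1]
    _ = ⁅⁅x, y⁆, z⁆ * (z * ⁅x, y⁆ * y) := by simp only [commutatorElement_def]; group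

/-- When the conjugating element of the Hall–Witt identity centralizes the inner term, the identity
becomes associativity. On root elements it reflects `(ab)d = a(bd)`. -/
theorem commutator_commutator_assoc {x y z : H} (hxz : Commute x z)
    (hy : Commute ⁅y, z⁆ y) (hz : Commute ⁅y, z⁆ z) (h1 : Commute z ⁅x, ⁅y, z⁆⁆)
    (h2 : Commute ⁅x, y⁆ ⁅x, ⁅y, z⁆⁆) (h3 : Commute y ⁅x, ⁅y, z⁆⁆) :
    ⁅⁅x, y⁆, z⁆ = ⁅x, ⁅y, z⁆⁆ := by
  have h := (semiconjBy_commutator_commutator hxz hy hz).eq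
  rw [((h1.mul_left h2).mul_left h3).eq] at h
  exact (mul_right_cancel h).symm

theorem commutatorElement_mul_left (x y z : H) : ⁅x * y, z⁆ = x * ⁅y, z⁆ * x⁻¹ * ⁅x, z⁆ := by
  simp only [commutatorElement_def]; group

end Group

section Central

variable {G : Type*} [Group G] {H : Type*} [Group H] {ε : H →* G}

namespace IsCentralExtension

theorem commute_of_map_eq_one (hε : IsCentralExtension ε) {x : H} (hx : ε x = 1) (y : H) :
    Commute x y :=
  (Subgroup.mem_center_iff.1 (hε.ker_le_center hx) y).symm

/-- Two preimages of one element differ by a central factor, which drops out of a commutator. This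
is what allows preimages to be chosen freely. -/
theorem commutatorElement_congr (hε : IsCentralExtension ε) {x x' y y' : H} (hx : ε x = ε x')
    (hy : ε y = ε y') : ⁅x, y⁆ = ⁅x', y'⁆ := by
  obtain ⟨c, rfl⟩ : ∃ c, x' = c * x := ⟨x' * x⁻¹, by group⟩
  obtain ⟨d, rfl⟩ : ∃ d, y' = d * y := ⟨y' * y⁻¹, by group⟩
  have hc : ε c = 1 := by simpa using hx
  have hd : ε d = 1 := by simpa using hy
  refine (SemiconjBy.commutatorElement_eq ?_).symm
  have h1 := (semiconjBy_commutatorElement x y)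
  have h2 : SemiconjBy x (d * y) (d * (⁅x, y⁆ * y)) :=
    SemiconjBy.mul_right (hε.commute_of_map_eq_one hd x).symm h1
  have h3 := SemiconjBy.mul_left (hε.commute_of_map_eq_one hc (d * (⁅x, y⁆ * y))) h2
  rwa [← mul_assoc, (hε.commute_of_map_eq_one hd ⁅x, y⁆).eq, mul_assoc] at h3

theorem commute_congr (hε : IsCentralExtension ε) {x x' y y' : H} (h : Commute x y)
    (hx : ε x = ε x') (hy : ε y = ε y') : Commute x' y' := by
  rw [← commutatorElement_eq_one_iff_commute] at h ⊢
  rw [← h, hε.commutatorElement_congr hx hy]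

/-- An element of `H` whose image commutes with those of `y` and `z` commutes with `⁅y, z⁆`. -/
theorem commute_commutatorElement (hε : IsCentralExtension ε) {x y z : H}
    (hy : Commute (ε x) (ε y)) (hz : Commute (ε x) (ε z)) : Commute x ⁅y, z⁆ := by
  -- Conjugation by `x` moves `y` and `z` only within their fibres, so their commutator is fixed.
  have key : ∀ t : H, Commute (ε x) (ε t) → ε (x * t * x⁻¹) = ε t := fun t ht => by
    simp [ht.eq]
  have h := hε.commutatorElement_congr (key y hy) (key z hz)
  have h2 : x * ⁅y, z⁆ * x⁻¹ = ⁅y, z⁆ := by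
    conv_rhs => rw [← h]
    simp only [commutatorElement_def]; group
  exact mul_inv_eq_iff_eq_mul.1 h2

/-- A chosen preimage. -/
noncomputable def section_ (hε : IsCentralExtension ε) (g : G) : H :=
  Function.surjInv hε.surjective g

@[simp] theorem map_section (hε : IsCentralExtension ε) (g : G) : ε (hε.section_ g) = g :=
  Function.surjInv_eq hε.surjective g

end IsCentralExtension

end Central

/-! ### Indices -/

namespace SignedIndex

variable {n : ℕ}

theorem neg_ne_self (i : SignedIndex n) : -i ≠ i := fun h => by
  have : (!i.2) = i.2 := congrArg Prod.snd h
  cases h : i.2 <;> simp [h] at this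

theorem neg_ne_self_and_neg_neg (i : SignedIndex n) : -i ≠ i ∧ - -i = i :=
  ⟨neg_ne_self i, neg_neg i⟩

theorem apart_iff {i j : SignedIndex n} : Apart i j ↔ i.1 ≠ j.1 := by
  refine ⟨fun h e => ?_, fun h => ⟨fun e => h (congrArg Prod.fst e), fun e => by rw [e] at h; exact h rfl⟩⟩
  by_cases h2 : i.2 = j.2
  · exact h.1 (Prod.ext e h2)
  · exact h.2 (Prod.ext e (by change i.2 = !j.2; revert h2; cases i.2 <;> cases j.2 <;> simp))

theorem exists_apart (i j k : SignedIndex 4) : ∃ m, Apart m i ∧ Apart m j ∧ Apart m k := by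
  have key : ∀ a b c : Fin 4, ∃ m, m ≠ a ∧ m ≠ b ∧ m ≠ c := by decide
  obtain ⟨m, h⟩ := key i.1 j.1 k.1
  let m' : SignedIndex 4 := (m, true)
  exact ⟨m', apart_iff.2 h.1, apart_iff.2 h.2.1, apart_iff.2 h.2.2⟩

/-- The dichotomy that singles out rank four: either a spare index pair is available, or the four
given pairs exhaust `Ω`. -/
theorem exists_apart_or (i j k h : SignedIndex 4) :
    (∃ m, Apart m i ∧ Apart m j ∧ Apart m k ∧ Apart m h) ∨
      (Apart i j ∧ Apart i k ∧ Apart i h ∧ Apart j k ∧ Apart j h ∧ Apart k h) := by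
  have key : ∀ a b c d : Fin 4, (∃ m, m ≠ a ∧ m ≠ b ∧ m ≠ c ∧ m ≠ d) ∨
      (a ≠ b ∧ a ≠ c ∧ a ≠ d ∧ b ≠ c ∧ b ≠ d ∧ c ≠ d) := by decide
  simp only [apart_iff]
  rcases key i.1 j.1 k.1 h.1 with ⟨m, hm⟩ | hm
  · exact Or.inl ⟨(m, true), hm⟩
  · exact Or.inr hm

/-- The condition on the indices under which `X_{ij}(a)` and `X_{hk}(b)` commute by definition. -/
def RootsCommute (i j h k : SignedIndex n) : Prop :=
  Apart i j ∧ Apart h k ∧ h ≠ j ∧ h ≠ -i ∧ k ≠ i ∧ k ≠ -j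

theorem card_eq_eight {i j k h : SignedIndex n} (hij : Apart i j) (hik : Apart i k)
    (hih : Apart i h) (hjk : Apart j k) (hjh : Apart j h) (hkh : Apart k h) :
    ({i, -i, j, -j, k, -k, h, -h} : Finset (SignedIndex n)).card = 8 := by
  rw [Finset.card_insert_of_notMem, Finset.card_insert_of_notMem, Finset.card_insert_of_notMem,
    Finset.card_insert_of_notMem, Finset.card_insert_of_notMem, Finset.card_insert_of_notMem,
    Finset.card_insert_of_notMem, Finset.card_singleton] <;>
  · simp only [Finset.mem_insert, Finset.mem_singleton, not_or]
    grind [Apart, neg_ne_self_and_neg_neg]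

/-- Any forbidden coincidence merges two index pairs and leaves at most six elements. -/
theorem rootsCommute_of_card {i j k h : SignedIndex n} (hij : Apart i j) (hkh : Apart k h)
    (hc : ({i, -i, j, -j, k, -k, h, -h} : Finset (SignedIndex n)).card = 8) :
    RootsCommute i j k h := by
  have key : ∀ {s : Finset (SignedIndex n)}, s.card ≤ 6 →
      ({i, -i, j, -j, k, -k, h, -h} : Finset (SignedIndex n)) ⊆ s → False := by
    intro s hs hsub
    have := Finset.card_le_card hsub
    omega
  refine ⟨hij, hkh, ?_, ?_, ?_, ?_⟩ <;> intro e <;> subst e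
  · exact key (Finset.card_le_six (a := i) (b := -i) (c := k) (d := -k) (e := h) (f := -h))
      (by simp)
  · exact key (Finset.card_le_six (a := i) (b := -i) (c := j) (d := -j) (e := h) (f := -h))
      (by simp [Finset.insert_subset_iff])
  · exact key (Finset.card_le_six (a := h) (b := -h) (c := j) (d := -j) (e := k) (f := -k))
      (by simp [Finset.insert_subset_iff])
  · exact key (Finset.card_le_six (a := i) (b := -i) (c := j) (d := -j) (e := k) (f := -k))
      (by simp [Finset.insert_subset_iff])

end SignedIndex

/-! ### The pseudo-involution and the form parameter -/

section Ring

open SignedIndex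

variable {R : Type u} [Ring R] (J : PseudoInvolution R) {n : ℕ}

namespace PseudoInvolution

@[simp] theorem lamInv_mul : J.lamInv * J.bar 1 = 1 := Ring.inverse_mul_cancel _ J.isUnit_bar_one

@[simp] theorem mul_lamInv : J.bar 1 * J.lamInv = 1 := Ring.mul_inverse_cancel _ J.isUnit_bar_one

@[simp] theorem lamInv_mul_assoc (a : R) : J.lamInv * (J.bar 1 * a) = a := by
  rw [← mul_assoc, lamInv_mul, one_mul]

@[simp] theorem mul_lamInv_assoc (a : R) : J.bar 1 * (J.lamInv * a) = a := by
  rw [← mul_assoc, mul_lamInv, one_mul]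

theorem bar_mul' (a b : R) : J.bar (a * b) = J.bar b * (J.lamInv * J.bar a) := by
  rw [J.bar_mul, mul_assoc]; rfl

/-- Obtained by applying `J.bar` to `J.bar 1 * J.lamInv = 1` and cancelling `J.lamInv`. -/
theorem bar_lamInv : J.bar J.lamInv = J.bar 1 * J.bar 1 := by
  have h : J.bar (J.bar 1 * J.lamInv) = J.bar J.lamInv * (J.lamInv * J.bar (J.bar 1)) :=
    J.bar_mul' _ _
  rw [mul_lamInv, J.bar_bar, mul_one] at h
  calc J.bar J.lamInv = J.bar J.lamInv * J.lamInv * J.bar 1 := by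
        rw [mul_assoc, lamInv_mul, mul_one]
    _ = J.bar 1 * J.bar 1 := by rw [← h]

@[simp] theorem bar_lamInv_mul (a : R) : J.bar (J.lamInv * a) = J.bar a * J.bar 1 := by
  rw [bar_mul', bar_lamInv, lamInv_mul_assoc]

@[simp] theorem bar_mul_lamInv (a : R) : J.bar (a * J.lamInv) = J.bar 1 * J.bar a := by
  rw [bar_mul', bar_lamInv, mul_assoc, mul_lamInv_assoc]

@[simp] theorem bar_eps_mul (i : SignedIndex n) (a : R) :
    J.bar (eps J i * a) * eps J i = J.bar a := by
  rcases eps_cases J i with ⟨h, -⟩ | ⟨h, -⟩ <;> simp [h, mul_assoc]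

theorem eps_neg_mul_mul_eps (i : SignedIndex n) (a : R) :
    eps J (-i) * J.bar 1 * (eps J i * a) = -a := by
  rcases eps_cases J i with ⟨h, h'⟩ | ⟨h, h'⟩ <;> simp [h, h']

theorem mul_eps_mul_eps_neg_mul (i : SignedIndex n) (a : R) :
    J.bar 1 * (eps J i * (eps J (-i) * a)) = -a := by
  rcases eps_cases J i with ⟨h, h'⟩ | ⟨h, h'⟩ <;> simp [h, h']

theorem eps_mul_surjective (i : SignedIndex n) (a : R) : ∃ r, a = eps J i * r := by
  rcases eps_cases J i with ⟨h, -⟩ | ⟨h, -⟩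
  · exact ⟨J.bar 1 * a, by simp [h]⟩
  · exact ⟨-a, by simp [h]⟩

end PseudoInvolution

end Ring

section Parameter

open SignedIndex

variable {R : Type u} [Ring R] {J : PseudoInvolution R}
  {V : Type v} [AddCommGroup V] [Module Rᵐᵒᵖ V] {B : AntiHermitianForm J V}

namespace AntiHermitianForm

theorem bar_form (x y : V) : J.bar (B.form x y) = -B.form y x := by
  rw [B.form_swap y x, neg_neg]

end AntiHermitianForm

namespace OddFormParameter

variable {L : OddFormParameter B}

/-- The map `(u, a) ↦ (u, -ā)` of `𝔏`. -/
def twist (ξ : L.toAddSubgroup) : L.toAddSubgroup :=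
  ⟨⟨ξ.1.vec, -J.bar ξ.1.scal⟩, L.neg_bar_mem ξ.2⟩

/-- The action of `R` on `𝔏`. -/
noncomputable def actOn (ξ : L.toAddSubgroup) (b : R) : L.toAddSubgroup :=
  ⟨ξ.1.act b, L.act_mem _ ξ.2 b⟩

/-- The element `(0, a + ā)` of `𝔏`. -/
def long (L : OddFormParameter B) (a : R) : L.toAddSubgroup :=
  ⟨⟨0, a + J.bar a⟩, L.min_le ⟨a, rfl⟩⟩

@[simp] theorem vec_twist (ξ : L.toAddSubgroup) : (twist ξ).1.vec = ξ.1.vec := rfl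
@[simp] theorem scal_twist (ξ : L.toAddSubgroup) : (twist ξ).1.scal = -J.bar ξ.1.scal := rfl
@[simp] theorem vec_actOn (ξ : L.toAddSubgroup) (b : R) :
    (actOn ξ b).1.vec = MulOpposite.op b • ξ.1.vec := rfl
@[simp] theorem scal_actOn (ξ : L.toAddSubgroup) (b : R) :
    (actOn ξ b).1.scal = J.bar b * J.lamInv * ξ.1.scal * b := rfl
@[simp] theorem vec_long (a : R) : (long L a).1.vec = 0 := rfl
@[simp] theorem scal_long (a : R) : (long L a).1.scal = a + J.bar a := rfl
@[simp] theorem vec_coe_add (ξ ζ : L.toAddSubgroup) : (ξ + ζ).1.vec = ξ.1.vec + ζ.1.vec := rfl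
@[simp] theorem scal_coe_add (ξ ζ : L.toAddSubgroup) :
    (ξ + ζ).1.scal = ξ.1.scal + ζ.1.scal + B.form ξ.1.vec ζ.1.vec := rfl

theorem ext_coe {ξ ζ : L.toAddSubgroup} (h1 : ξ.1.vec = ζ.1.vec) (h2 : ξ.1.scal = ζ.1.scal) :
    ξ = ζ :=
  Subtype.ext (Heisenberg.ext h1 h2)

theorem form_self (ξ : L.toAddSubgroup) :
    B.form ξ.1.vec ξ.1.vec = ξ.1.scal - J.bar ξ.1.scal :=
  eq_sub_of_add_eq' (L.le_max ξ.2).symm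

@[simp] theorem twist_twist (ξ : L.toAddSubgroup) : twist (twist ξ) = ξ :=
  ext_coe rfl (by simp [J.bar_bar])

/-- The order is reversed because `J.bar` sends `B(u, v)` to `-B(v, u)`. -/
theorem twist_add (ξ ζ : L.toAddSubgroup) : twist (ξ + ζ) = twist ζ + twist ξ :=
  ext_coe (by simp [add_comm]) (by simp [AntiHermitianForm.bar_form]; abel)

@[simp] theorem actOn_one (ξ : L.toAddSubgroup) : actOn ξ 1 = ξ := ext_coe (by simp) (by simp)

theorem twist_long (a : R) : twist (long L a) = -long L a :=
  ext_coe (by simp) (by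
    rw [AddSubgroup.coe_neg, Heisenberg.scal_neg]; simp [J.bar_bar]; abel)

end OddFormParameter

end Parameter

/-! ### Relations in the Steinberg group -/

section Steinberg

open SignedIndex OddFormParameter

variable {R : Type u} [Ring R] {J : PseudoInvolution R}
  {V : Type v} [AddCommGroup V] [Module Rᵐᵒᵖ V] {B : AntiHermitianForm J V}

namespace StU

variable {n : ℕ} (L : OddFormParameter B)

theorem mk_eq_of_rel {p q : FreeGroup (StUGen n L)} (h : StUGen.Rel L p q) :
    PresentedGroup.mk {r : FreeGroup (StUGen n L) | ∃ p q, StUGen.Rel L p q ∧ r = p * q⁻¹} p =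
      PresentedGroup.mk _ q := by
  rw [← mul_inv_eq_one, ← map_inv, ← map_mul]
  exact PresentedGroup.one_of_mem ⟨p, q, h, rfl⟩

open Classical in
/-- `X_{ij}(a)`, extended by `1` to the pairs `i ∈ {±j}`. -/
noncomputable def root (i j : SignedIndex n) (a : R) : StU n L :=
  if h : Apart i j then StU.X L i j h a else 1

/-- The element `X_i(ξ)`. -/
def short (i : SignedIndex n) (ξ : L.toAddSubgroup) : StU n L :=
  PresentedGroup.of (StUGen.short i ξ)

variable {L}

theorem root_eq {i j : SignedIndex n} (h : Apart i j) (a : R) : root L i j a = StU.X L i j h a :=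
  dif_pos h

theorem root_neg_neg {i j : SignedIndex n} (h : Apart i j) (a : R) :
    root L i j a = root L (-j) (-i) (eps J (-j) * J.bar a * eps J i) := by
  rw [root_eq h, root_eq h.symm.neg_left.neg_right]
  exact mk_eq_of_rel L (.r0 i j h a)

/-- Normalizing coefficients as `ε_i a` absorbs the trailing `ε_i` of the symmetry relation, so no
case split on signs is needed later. -/
theorem root_eps_mul {i j : SignedIndex n} (h : Apart i j) (a : R) :
    root L i j (eps J i * a) = root L (-j) (-i) (eps J (-j) * J.bar a) := by
  rw [root_neg_neg h, mul_assoc, J.bar_eps_mul]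

theorem root_mul_root {i j : SignedIndex n} (h : Apart i j) (a b : R) :
    root L i j a * root L i j b = root L i j (a + b) := by
  simp only [root_eq h]
  exact mk_eq_of_rel L (.r1 i j h a b)

theorem short_mul_short (i : SignedIndex n) (ξ ζ : L.toAddSubgroup) :
    short L i ξ * short L i ζ = short L i (ξ + ζ) :=
  mk_eq_of_rel L (.r2 i ξ ζ)

theorem commute_root_root {i j h k : SignedIndex n} (hc : RootsCommute i j h k) (a b : R) :
    Commute (root L i j a) (root L h k b) := by
  obtain ⟨hij, hhk, h1, h2, h3, h4⟩ := hc
  rw [root_eq hij, root_eq hhk, ← commutatorElement_eq_one_iff_commute]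
  exact mk_eq_of_rel L (.r3 i j h k hij hhk h1 h2 h3 h4 a b)

theorem commute_short_root {i j k : SignedIndex n} (hjk : Apart j k) (h1 : j ≠ -i) (h2 : k ≠ i)
    (ξ : L.toAddSubgroup) (a : R) : Commute (short L i ξ) (root L j k a) := by
  rw [root_eq hjk, ← commutatorElement_eq_one_iff_commute]
  exact mk_eq_of_rel L (.r4 i j k hjk h1 h2 ξ a)

theorem commutator_root_root {i j k : SignedIndex n} (hij : Apart i j) (hjk : Apart j k)
    (hik : Apart i k) (a b : R) :
    ⁅root L i j a, root L j k b⁆ = root L i k (a * b) := by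
  rw [root_eq hij, root_eq hjk, root_eq hik]
  exact mk_eq_of_rel L (.r5 i j k hij hjk hik a b)

theorem commutator_short_short {i j : SignedIndex n} (h : Apart i j) (ξ ζ : L.toAddSubgroup) :
    ⁅short L i ξ, short L j ζ⁆ = root L i (-j) (eps J i * B.form ξ.1.vec ζ.1.vec) := by
  rw [root_eq h.neg_right]
  exact mk_eq_of_rel L (.r6 i j h ξ ζ)

theorem commutator_short_root {i j : SignedIndex n} (h : Apart i j) (ξ : L.toAddSubgroup) (b : R) :
    ⁅short L i ξ, root L (-i) j b⁆ =
      root L i j (eps J i * ξ.1.scal * b) * short L (-j) (actOn (twist ξ) b) := by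
  rw [root_eq h, root_eq h.neg_left]
  exact mk_eq_of_rel L (.r8 i j h ξ b)

theorem commutator_root_root_neg {i j : SignedIndex n} (h : Apart i j) (r : R) :
    ⁅root L i j (eps J i * r), root L j (-i) 1⁆ = short L i (long L r) := by
  rw [root_eq h, root_eq h.symm.neg_right]
  refine (mk_eq_of_rel L (.r9 i j h _ 1)).trans (congrArg (short L i) (ext_coe rfl ?_))
  simp only [scal_long, mul_one, J.mul_lamInv, one_mul, J.eps_neg_mul_mul_eps, J.bar_eps_mul,
    neg_neg]

theorem exists_commutator_root_root_neg {i j : SignedIndex n} (h : Apart i j) (a b : R) :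
    ∃ ξ, ⁅root L i j a, root L j (-i) b⁆ = short L i ξ := by
  rw [root_eq h, root_eq h.symm.neg_right]
  exact ⟨_, mk_eq_of_rel L (.r9 i j h a b)⟩

theorem root_zero {i j : SignedIndex n} (h : Apart i j) : root L i j 0 = 1 := by
  simpa using root_mul_root (L := L) h 0 0

theorem root_inv {i j : SignedIndex n} (h : Apart i j) (a : R) :
    (root L i j a)⁻¹ = root L i j (-a) := by
  rw [inv_eq_iff_mul_eq_one, root_mul_root h, add_neg_cancel, root_zero h]

theorem short_zero (i : SignedIndex n) : short L i 0 = 1 := by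
  simpa using short_mul_short (L := L) i 0 0

theorem short_inv (i : SignedIndex n) (ξ : L.toAddSubgroup) :
    (short L i ξ)⁻¹ = short L i (-ξ) := by
  rw [inv_eq_iff_mul_eq_one, short_mul_short, add_neg_cancel, short_zero]

end StU

end Steinberg

/-! ### Lifting the relations between root elements -/

section Lift

open SignedIndex OddFormParameter

variable {R : Type u} [Ring R] {J : PseudoInvolution R}
  {V : Type v} [AddCommGroup V] [Module Rᵐᵒᵖ V] {B : AntiHermitianForm J V}
  {L : OddFormParameter B} {H : Type w} [Group H] {ε : H →* StU 4 L}

/-- Preimages of root elements with pairwise unrelated indices commute. -/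
def ApartRootsCommute (ε : H →* StU 4 L) : Prop :=
  ∀ i j k h : SignedIndex 4, Apart i j → Apart i k → Apart i h → Apart j k → Apart j h →
    Apart k h → ∀ (a b : R) (x y : H), ε x = StU.root L i j a → ε y = StU.root L k h b →
      Commute x y

namespace IsCentralExtension

theorem commute_root_root (hε : IsCentralExtension ε) (hD : ApartRootsCommute ε)
    {i j h k : SignedIndex 4} {a b : R} {x y : H}
    (hx : ε x = StU.root L i j a) (hy : ε y = StU.root L h k b)
    (hc : RootsCommute i j h k := by grind [Apart, RootsCommute, neg_ne_self_and_neg_neg]) :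
    Commute x y := by
  rcases exists_apart_or i j h k with ⟨m, h1, h2, h3, h4⟩ | ⟨h1, h2, h3, h4, h5, h6⟩
  · refine hε.commute_congr (x := x) (y := ⁅hε.section_ (StU.root L h m b),
      hε.section_ (StU.root L m k 1)⁆) (hε.commute_commutatorElement ?_ ?_) rfl ?_
    · rw [hx, map_section]
      exact StU.commute_root_root
        (by grind [Apart, RootsCommute, neg_ne_self_and_neg_neg]) _ _
    · rw [hx, map_section]
      exact StU.commute_root_root
        (by grind [Apart, RootsCommute, neg_ne_self_and_neg_neg]) _ _
    · rw [map_commutatorElement, map_section, map_section,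
        StU.commutator_root_root h3.symm h4 hc.2.1, mul_one, hy]
  · exact hD i j h k h1 h2 h3 h4 h5 h6 a b x y hx hy

/-- At most three index pairs occur, so a fourth always serves as auxiliary index and
`ApartRootsCommute` is not needed. -/
theorem commute_short_root (hε : IsCentralExtension ε) {i j k : SignedIndex 4}
    {ξ : L.toAddSubgroup} {a : R} {x y : H}
    (hx : ε x = StU.short L i ξ) (hy : ε y = StU.root L j k a)
    (hc : Apart j k ∧ j ≠ -i ∧ k ≠ i := by grind [Apart, neg_ne_self_and_neg_neg]) :
    Commute x y := by
  obtain ⟨m, h1, h2, h3⟩ := exists_apart i j k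
  refine hε.commute_congr (x := x) (y := ⁅hε.section_ (StU.root L j m a),
      hε.section_ (StU.root L m k 1)⁆) (hε.commute_commutatorElement ?_ ?_) rfl ?_
  · rw [hx, map_section]
    exact StU.commute_short_root h2.symm hc.2.1 h1.1 _ _
  · rw [hx, map_section]
    exact StU.commute_short_root h3 h1.2 hc.2.2 _ _
  · rw [map_commutatorElement, map_section, map_section,
      StU.commutator_root_root h2.symm h3 hc.1, mul_one, hy]

/-- The standard preimage of `X_{ij}(a)`. -/
noncomputable def rootLift (hε : IsCentralExtension ε) (i j : SignedIndex 4) (a : R) : H :=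
  ⁅hε.section_ (StU.root L i (exists_apart i j j).choose a),
    hε.section_ (StU.root L (exists_apart i j j).choose j 1)⁆

@[simp] theorem map_rootLift (hε : IsCentralExtension ε) {i j : SignedIndex 4} (a : R)
    (hij : Apart i j := by grind [Apart, neg_ne_self_and_neg_neg]) :
    ε (hε.rootLift i j a) = StU.root L i j a := by
  obtain ⟨h1, h2, -⟩ := (exists_apart i j j).choose_spec
  rw [rootLift, map_commutatorElement, map_section, map_section,
    StU.commutator_root_root h1.symm h2 hij, mul_one]

theorem commute_rootLift_rootLift (hε : IsCentralExtension ε) (hD : ApartRootsCommute ε)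
    {i j h k : SignedIndex 4} (a b : R)
    (hc : RootsCommute i j h k := by grind [Apart, RootsCommute, neg_ne_self_and_neg_neg]) :
    Commute (hε.rootLift i j a) (hε.rootLift h k b) :=
  hε.commute_root_root hD (hε.map_rootLift a hc.1) (hε.map_rootLift b hc.2.1) hc

/-- Hall–Witt for lifts of `X_{il}(a)`, `X_{lk}(b)`, `X_{kj}(d)`. The outer two use all four index
pairs, so their commutation is exactly where `hD` enters. -/
theorem commutator_section_assoc (hε : IsCentralExtension ε) (hD : ApartRootsCommute ε)
    {i j k l : SignedIndex 4} (hij : Apart i j) (hik : Apart i k) (hil : Apart i l)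
    (hjk : Apart j k) (hjl : Apart j l) (hkl : Apart k l) (a b d : R) :
    ⁅hε.section_ (StU.root L i k (a * b)), hε.section_ (StU.root L k j d)⁆ =
      ⁅hε.section_ (StU.root L i l a), hε.section_ (StU.root L l j (b * d))⁆ := by
  have hx := hε.map_section (StU.root L i l a)
  have hy := hε.map_section (StU.root L l k b)
  have hz := hε.map_section (StU.root L k j d)
  generalize hε.section_ (StU.root L i l a) = x at *
  generalize hε.section_ (StU.root L l k b) = y at *
  generalize hε.section_ (StU.root L k j d) = z at *
  have hxy : ε ⁅x, y⁆ = StU.root L i k (a * b) := by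
    rw [map_commutatorElement, hx, hy, StU.commutator_root_root hil hkl.symm hik]
  have hyz : ε ⁅y, z⁆ = StU.root L l j (b * d) := by
    rw [map_commutatorElement, hy, hz, StU.commutator_root_root hkl.symm hjk.symm hjl.symm]
  have hxw : ε ⁅x, ⁅y, z⁆⁆ = StU.root L i j (a * (b * d)) := by
    rw [map_commutatorElement, hx, hyz, StU.commutator_root_root hil hjl.symm hij]
  have key : ⁅⁅x, y⁆, z⁆ = ⁅x, ⁅y, z⁆⁆ :=
    commutator_commutator_assoc (hε.commute_root_root hD hx hz) (hε.commute_root_root hD hyz hy)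
      (hε.commute_root_root hD hyz hz) (hε.commute_root_root hD hz hxw)
      (hε.commute_root_root hD hxy hxw) (hε.commute_root_root hD hy hxw)
  rw [hε.commutatorElement_congr (x' := ⁅x, y⁆) (y' := z) (by rw [map_section, hxy]) rfl, key]
  exact hε.commutatorElement_congr rfl (by rw [map_section, hyz])

theorem commutator_section_eq (hε : IsCentralExtension ε) (hD : ApartRootsCommute ε)
    {i j k m : SignedIndex 4} (hij : Apart i j) (hik : Apart i k) (hjk : Apart j k)
    (him : Apart i m) (hjm : Apart j m) (a b : R) :
    ⁅hε.section_ (StU.root L i k a), hε.section_ (StU.root L k j b)⁆ =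
      ⁅hε.section_ (StU.root L i m (a * b)), hε.section_ (StU.root L m j 1)⁆ := by
  by_cases hkm : Apart k m
  · have h := hε.commutator_section_assoc hD hij him hik hjm hjk hkm.symm a b 1
    rw [mul_one] at h
    exact h.symm
  -- Here `m = ±k`, and the change of auxiliary index goes through a third pair `l`.
  · obtain ⟨l, hli, hlj, hlk⟩ := exists_apart i j k
    have hlm : Apart l m := by grind [Apart, neg_ne_self_and_neg_neg]
    have h1 := hε.commutator_section_assoc hD hij hli.symm hik hlj.symm hjk hlk a b 1
    have h2 := hε.commutator_section_assoc hD hij hli.symm him hlj.symm hjm hlm (a * b) 1 1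
    rw [mul_one] at h1 h2
    rw [mul_one] at h2
    rw [← h1, h2]

/-- The lift of the relation `[X_{ij}(a), X_{jk}(b)] = X_{ik}(ab)`. -/
theorem commutator_root_root (hε : IsCentralExtension ε) (hD : ApartRootsCommute ε)
    {i k j : SignedIndex 4} {a b : R} {x y : H}
    (hx : ε x = StU.root L i k a) (hy : ε y = StU.root L k j b)
    (hc : Apart i j ∧ Apart i k ∧ Apart j k := by grind [Apart, neg_ne_self_and_neg_neg]) :
    ⁅x, y⁆ = hε.rootLift i j (a * b) := by
  obtain ⟨hi, hj, -⟩ := (exists_apart i j j).choose_spec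
  rw [rootLift, ← hε.commutator_section_eq hD hc.1 hc.2.1 hc.2.2 hi.symm hj.symm]
  exact hε.commutatorElement_congr (by rw [hx, map_section]) (by rw [hy, map_section])

theorem semiconjBy_root_root (hε : IsCentralExtension ε) (hD : ApartRootsCommute ε)
    {i k j : SignedIndex 4} {a b : R} {x y : H}
    (hx : ε x = StU.root L i k a) (hy : ε y = StU.root L k j b)
    (hc : Apart i j ∧ Apart i k ∧ Apart j k := by grind [Apart, neg_ne_self_and_neg_neg]) :
    SemiconjBy x y (hε.rootLift i j (a * b) * y) := by
  rw [← hε.commutator_root_root hD hx hy hc]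
  exact semiconjBy_commutatorElement x y

theorem rootLift_mul_rootLift (hε : IsCentralExtension ε) (hD : ApartRootsCommute ε)
    {i j : SignedIndex 4} (hij : Apart i j) (a b : R) :
    hε.rootLift i j a * hε.rootLift i j b = hε.rootLift i j (a + b) := by
  obtain ⟨m, hmi, hmj, -⟩ := exists_apart i j j
  have ha := hε.map_rootLift a hmi.symm
  have hb := hε.map_rootLift b hmi.symm
  have h1 := hε.map_rootLift 1 hmj
  have hab : ε (hε.rootLift i m a * hε.rootLift i m b) = StU.root L i m (a + b) := by
    rw [map_mul, ha, hb, StU.root_mul_root hmi.symm]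
  have key := hε.commutator_root_root hD hab h1
  rw [commutatorElement_mul_left, hε.commutator_root_root hD ha h1,
    hε.commutator_root_root hD hb h1, mul_one, mul_one, mul_one,
    (hε.commute_rootLift_rootLift hD a b : Commute (hε.rootLift i m a) (hε.rootLift i j b)).eq,
    mul_inv_cancel_right] at key
  rw [← key]
  exact (hε.commute_rootLift_rootLift hD a b).eq

theorem rootLift_zero (hε : IsCentralExtension ε) (hD : ApartRootsCommute ε)
    {i j : SignedIndex 4} (hij : Apart i j) : hε.rootLift i j 0 = 1 := by
  simpa using hε.rootLift_mul_rootLift hD hij 0 0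

theorem rootLift_inv (hε : IsCentralExtension ε) (hD : ApartRootsCommute ε)
    {i j : SignedIndex 4} (hij : Apart i j) (a : R) :
    (hε.rootLift i j a)⁻¹ = hε.rootLift i j (-a) := by
  rw [inv_eq_iff_mul_eq_one, hε.rootLift_mul_rootLift hD hij, add_neg_cancel,
    hε.rootLift_zero hD hij]

/-- The symmetry in the Steinberg group, applied to both factors of the defining commutator,
exchanges their roles. The commutator is thereby inverted, which is why the computation starts from
`-a`. -/
theorem rootLift_neg_neg (hε : IsCentralExtension ε) (hD : ApartRootsCommute ε)
    {i j : SignedIndex 4} (hij : Apart i j) (a : R) :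
    hε.rootLift i j a = hε.rootLift (-j) (-i) (eps J (-j) * J.bar a * eps J i) := by
  obtain ⟨m, hmi, hmj, -⟩ := exists_apart i j j
  have ha := hε.map_rootLift (-a) hmi.symm
  have h1 := hε.map_rootLift 1 hmj
  have e1 := hε.commutator_root_root hD ha h1
  rw [StU.root_neg_neg hmi.symm] at ha
  rw [StU.root_neg_neg hmj] at h1
  have e2 := hε.commutator_root_root hD h1 ha
  rw [← commutatorElement_inv, e1, hε.rootLift_inv hD hij, mul_one, neg_neg] at e2
  rw [e2]
  congr 1
  simp only [mul_assoc, J.mul_eps_mul_eps_neg_mul, map_neg, neg_mul, neg_neg]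

theorem rootLift_eps_mul (hε : IsCentralExtension ε) (hD : ApartRootsCommute ε)
    {i j : SignedIndex 4} (hij : Apart i j) (a : R) :
    hε.rootLift i j (eps J i * a) = hε.rootLift (-j) (-i) (eps J (-j) * J.bar a) := by
  rw [hε.rootLift_neg_neg hD hij, mul_assoc, J.bar_eps_mul]

end IsCentralExtension

end Lift

/-! ### Lifting the relations involving short elements -/

/-- The group-theoretic core of changing the auxiliary index. By Hall–Witt, `z f D' y` conjugates `e
D` to `⁅f D', z⁆ = e E D₂`. Conjugating factor by factor instead, `y` contributes `s`, `D'`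
contributes `t`, and `z` turns `s t = E` into `⁅z, E⁆ E`; comparison gives `D₂`. -/
theorem eq_commutator_mul_of_transfer {H : Type*} [Group H] {x y z e f D D' D₂ E s t : H}
    (hxz : Commute x z) (hwy : Commute ⁅y, z⁆ y) (hwz : Commute ⁅y, z⁆ z)
    (hxw : ⁅x, ⁅y, z⁆⁆ = e * D) (hxy : ⁅x, y⁆ = f * D') (hDz : ⁅D', z⁆ = E * D₂)
    (hfz : ⁅f, z⁆ = e) (hye : SemiconjBy y e (e * s)) (hyD : Commute y D)
    (hDe : Commute D' e) (hDs : Commute D' s) (hDD : SemiconjBy D' D (t * D))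
    (hfe : Commute f e) (hfs : Commute f s) (hft : Commute f t) (hfD : Commute f D)
    (hst : s * t = E) (hze : Commute z e) (hzD : Commute z D)
    (hfE : Commute f E) (hfD₂ : Commute f D₂) (heE : Commute e E) (heD₂ : Commute e D₂)
    (hED : Commute E D) (hED₂ : Commute E D₂) :
    D₂ = ⁅z, E⁆ * D := by
  have h := semiconjBy_commutator_commutator hxz hwy hwz
  rw [hxw, hxy] at h
  have h1 : SemiconjBy y (e * D) (e * s * D) := hye.mul_right hyD
  have h2 : SemiconjBy D' (e * s * D) (e * s * (t * D)) :=
    (SemiconjBy.mul_right hDe hDs).mul_right hDD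
  have h3 : SemiconjBy f (e * s * (t * D)) (e * s * (t * D)) :=
    (hfe.mul_right hfs).mul_right (hft.mul_right hfD)
  have h4 : SemiconjBy z (e * s * (t * D)) (e * (⁅z, E⁆ * E) * D) := by
    have h5 : SemiconjBy z (e * E * D) (e * (⁅z, E⁆ * E) * D) :=
      (SemiconjBy.mul_right hze (semiconjBy_commutatorElement z E)).mul_right hzD
    rwa [← hst, ← mul_assoc e s t, mul_assoc _ t D, hst] at h5
  have h6 := h4.mul_left ((h3.mul_left h2).mul_left h1)
  have h7 : ⁅f * D', z⁆ = e * (⁅z, E⁆ * E) * D :=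
    mul_right_cancel (h.eq.symm.trans (by simpa only [mul_assoc] using h6.eq))
  rw [commutatorElement_mul_left, hDz, hfz, (hfE.mul_right hfD₂).eq, mul_inv_cancel_right,
    ← (heE.mul_right heD₂).eq, hED₂.eq, mul_assoc e, mul_assoc, hED.eq, ← mul_assoc ⁅z, E⁆] at h7
  exact mul_right_cancel (mul_left_cancel h7)

/-! ### Commutators of short elements, and the change of auxiliary index. -/

section Lift

open SignedIndex OddFormParameter

variable {R : Type u} [Ring R] {J : PseudoInvolution R}
  {V : Type v} [AddCommGroup V] [Module Rᵐᵒᵖ V] {B : AntiHermitianForm J V}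
  {L : OddFormParameter B} {H : Type w} [Group H] {ε : H →* StU 4 L}

namespace IsCentralExtension

/-- The preimage of `X_i((u, -ā) ↼ b)`, for `ξ = (u, a)`, obtained from `[X_j(ξ), X_{-j,-i}(b)]`. -/
noncomputable def shortLiftVia (hε : IsCentralExtension ε) (j i : SignedIndex 4)
    (ξ : L.toAddSubgroup) (b : R) : H :=
  (hε.rootLift j (-i) (eps J j * (ξ.1.scal * b)))⁻¹ *
    ⁅hε.section_ (StU.short L j ξ), hε.rootLift (-j) (-i) b⁆

theorem commutator_section_rootLift (hε : IsCentralExtension ε) (j i : SignedIndex 4)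
    (ξ : L.toAddSubgroup) (b : R) :
    ⁅hε.section_ (StU.short L j ξ), hε.rootLift (-j) (-i) b⁆ =
      hε.rootLift j (-i) (eps J j * (ξ.1.scal * b)) * hε.shortLiftVia j i ξ b := by
  rw [shortLiftVia, mul_inv_cancel_left]

theorem map_shortLiftVia (hε : IsCentralExtension ε) {j i : SignedIndex 4}
    (ξ : L.toAddSubgroup) (b : R)
    (hji : Apart j i := by grind [Apart, neg_ne_self_and_neg_neg]) :
    ε (hε.shortLiftVia j i ξ b) = StU.short L i (actOn (twist ξ) b) := by
  rw [shortLiftVia, map_mul, map_inv, map_commutatorElement, map_section, hε.map_rootLift,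
    hε.map_rootLift, StU.commutator_short_root hji.neg_right, neg_neg, mul_assoc,
    inv_mul_cancel_left]

/-- The lift of the relation `[X_i(u, a), X_j(v, b)] = X_{i,-j}(ε_i B(u, v))`. -/
theorem commutator_short_short (hε : IsCentralExtension ε) (hD : ApartRootsCommute ε)
    {i j : SignedIndex 4} {ξ ζ : L.toAddSubgroup} {x z : H}
    (hx : ε x = StU.short L i ξ) (hz : ε z = StU.short L j ζ)
    (hij : Apart i j := by grind [Apart, neg_ne_self_and_neg_neg]) :
    ⁅x, z⁆ = hε.rootLift i (-j) (eps J i * B.form ξ.1.vec ζ.1.vec) := by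
  -- The preimage of `X_i(ξ)` is replaced by `g⁻¹ ⁅u, y⁆` built through `k`. Then `z` commutes with
  -- `g` and `y`, so only its action on `u` matters.
  obtain ⟨k, hki, hkj, -⟩ := exists_apart i j j
  have hv := hε.map_shortLiftVia (twist ξ) 1 hki
  rw [twist_twist, actOn_one] at hv
  rw [hε.commutatorElement_congr (hx.trans hv.symm) rfl, shortLiftVia]
  have hu := hε.map_section (StU.short L k (twist ξ))
  generalize hε.section_ (StU.short L k (twist ξ)) = u at *
  have hy := hε.map_rootLift (1 : R) (i := -k) (j := -i)
  generalize hε.rootLift (-k) (-i) 1 = y at *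
  have hg := hε.map_rootLift (eps J k * ((twist ξ).1.scal * 1)) (i := k) (j := -i)
  generalize hε.rootLift k (-i) (eps J k * ((twist ξ).1.scal * 1)) = g at *
  have hzg : Commute z g := hε.commute_short_root hz hg
  have hzy : Commute z y := hε.commute_short_root hz hy
  -- Chosen so that `z u z⁻¹ = u q`; its image is a root element, which reduces the problem to `⁅q,
  -- y⁆`.
  set q := u⁻¹ * z * u * z⁻¹ with hq
  have hq' : ε q = StU.root L j (-k) (eps J j * -J.bar (B.form ξ.1.vec ζ.1.vec)) := by
    have : q = ⁅u⁻¹, z⁆ := by rw [hq, commutatorElement_def, inv_inv]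
    rw [this, map_commutatorElement, map_inv, hu, StU.short_inv, hz,
      StU.commutator_short_short hkj, StU.root_eps_mul hkj.neg_right, neg_neg]
    congr 2
    simp
  set r := hε.rootLift j (-i) (eps J j * -J.bar (B.form ξ.1.vec ζ.1.vec) * 1) with hr
  have hqy : ⁅q, y⁆ = r := hε.commutator_root_root hD hq' hy
  have hrm : ε r = _ := hε.map_rootLift _
  have hur : Commute u r := hε.commute_short_root hu hrm
  have h1 : SemiconjBy z ⁅u, y⁆ (r * ⁅u, y⁆) := by
    have e1 : z * ⁅u, y⁆ * z⁻¹ = ⁅u * q, z * y * z⁻¹⁆ := by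
      rw [hq]; simp only [commutatorElement_def]; group
    rw [hzy.eq, mul_inv_cancel_right, commutatorElement_mul_left, hqy, hur.eq,
      mul_inv_cancel_right] at e1
    exact mul_inv_eq_iff_eq_mul.1 e1
  have hrg : Commute g r := hε.commute_root_root hD hg hrm
  rw [commutatorElement_mul_left, ← commutatorElement_inv, h1.commutatorElement_eq,
    commutatorElement_eq_one_iff_commute.2 hzg.symm.inv_left, mul_one,
    (hrg.inv_inv).eq, mul_inv_cancel_right, hr, hε.rootLift_inv hD, mul_one, ← mul_neg, neg_neg,
    hε.rootLift_eps_mul hD, neg_neg, J.bar_bar]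
  all_goals grind [Apart, neg_ne_self_and_neg_neg]

/-- Passing from one auxiliary index to another. -/
theorem shortLiftVia_transfer (hε : IsCentralExtension ε) (hD : ApartRootsCommute ε)
    {i j k : SignedIndex 4} (hij : Apart i j) (hik : Apart i k) (hjk : Apart j k)
    (ξ : L.toAddSubgroup) (b d : R) :
    hε.shortLiftVia (-k) i (actOn (twist ξ) b) d =
      ⁅hε.rootLift k (-i) d,
        hε.rootLift (-k) (-i) (eps J (-k) * ((actOn (twist ξ) b).1.scal * d))⁆ *
        hε.shortLiftVia j i ξ (b * d) := by
  have hx := hε.map_section (StU.short L j ξ)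
  have hy := hε.map_rootLift b (i := -j) (j := k)
  have hz := hε.map_rootLift d (i := k) (j := -i)
  have hyz : ⁅hε.rootLift (-j) k b, hε.rootLift k (-i) d⁆ = hε.rootLift (-j) (-i) (b * d) :=
    hε.commutator_root_root hD hy hz
  have hw := hε.map_rootLift (b * d) (i := -j) (j := -i)
  have he := hε.map_rootLift (eps J j * (ξ.1.scal * (b * d))) (i := j) (j := -i)
  have hDj := hε.map_shortLiftVia ξ (b * d) hij.symm
  have hf := hε.map_rootLift (eps J j * (ξ.1.scal * b)) (i := j) (j := k)
  have hD' := hε.map_shortLiftVia ξ b (j := j) (i := -k)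
  have hE := hε.map_rootLift (eps J (-k) * ((actOn (twist ξ) b).1.scal * d)) (i := -k) (j := -i)
  have hD₂ := hε.map_shortLiftVia (actOn (twist ξ) b) d (j := -k) (i := i)
  have hs := hε.map_rootLift (eps J (-k) * -(J.bar b * (J.lamInv * (ξ.1.scal * (b * d)))))
    (i := -k) (j := -i)
  have ht := hε.map_rootLift (eps J (-k) * (J.bar b * (J.lamInv *
    (B.form ξ.1.vec ξ.1.vec * (b * d))))) (i := -k) (j := -i)
  refine eq_commutator_mul_of_transfer (x := hε.section_ (StU.short L j ξ))
    (y := hε.rootLift (-j) k b) (z := hε.rootLift k (-i) d)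
    (e := hε.rootLift j (-i) (eps J j * (ξ.1.scal * (b * d))))
    (f := hε.rootLift j k (eps J j * (ξ.1.scal * b)))
    (D' := hε.shortLiftVia j (-k) ξ b)
    (s := hε.rootLift (-k) (-i) (eps J (-k) * -(J.bar b * (J.lamInv * (ξ.1.scal * (b * d))))))
    (t := hε.rootLift (-k) (-i) (eps J (-k) * (J.bar b * (J.lamInv *
      (B.form ξ.1.vec ξ.1.vec * (b * d))))))
    (hε.commute_short_root hx hz) ?_ ?_ ?_ ?_ ?_ ?_ ?_ (hε.commute_short_root hDj hy).symm
    (hε.commute_short_root hD' he) (hε.commute_short_root hD' hs) ?_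
    (hε.commute_root_root hD hf he) (hε.commute_root_root hD hf hs)
    (hε.commute_root_root hD hf ht) (hε.commute_short_root hDj hf).symm ?_
    (hε.commute_root_root hD hz he) (hε.commute_short_root hDj hz).symm
    (hε.commute_root_root hD hf hE) (hε.commute_short_root hD₂ hf).symm
    (hε.commute_root_root hD he hE) (hε.commute_short_root hD₂ he).symm
    (hε.commute_short_root hDj hE).symm (hε.commute_short_root hD₂ hE).symm
  · rw [hyz]; exact hε.commute_root_root hD hw hy
  · rw [hyz]; exact hε.commute_root_root hD hw hz
  · rw [hyz, hε.commutator_section_rootLift]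
  · have h := hε.commutator_section_rootLift j (-k) ξ b
    rwa [neg_neg] at h
  · have h := hε.commutator_section_rootLift (-k) i (actOn (twist ξ) b) d
    rw [neg_neg] at h
    rw [← h]
    exact hε.commutatorElement_congr (by rw [hD', hε.map_section]) rfl
  · rw [hε.commutator_root_root hD hf hz, mul_assoc, mul_assoc]
  -- Reindexed as a root element from `i` to `-j`, `e` has a root commutator with `y`. Inverting
  -- that commutator and reindexing back produces `s`.
  · have he' := he
    rw [StU.root_eps_mul (by grind [Apart, neg_ne_self_and_neg_neg]), neg_neg] at he'
    have h := hε.commutator_root_root hD he' hy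
    rw [mul_assoc, ← inv_inj, commutatorElement_inv, hε.rootLift_inv hD hik, ← mul_neg,
      hε.rootLift_eps_mul hD hik, map_neg, J.bar_mul', J.bar_bar] at h
    have h2 := semiconjBy_commutatorElement (hε.rootLift (-j) k b)
      (hε.rootLift j (-i) (eps J j * (ξ.1.scal * (b * d))))
    rw [h] at h2
    rwa [(hε.commute_root_root hD he hs).eq]
  · have h := hε.commutator_short_short hD hD' hDj
    have h2 := semiconjBy_commutatorElement (hε.shortLiftVia j (-k) ξ b)
      (hε.shortLiftVia j i ξ (b * d))
    rw [h] at h2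
    simpa only [vec_actOn, vec_twist, B.form_smul_smul, mul_assoc] using h2
  -- With `ξ = (u, a)` and `B(u, u) = a - ā`, the terms in `a` cancel and only the one in `-ā`
  -- survives, which is the scalar part of `actOn (twist ξ) b`.
  · rw [hε.rootLift_mul_rootLift hD, ← mul_add]
    · congr 2
      simp only [form_self, mul_assoc, sub_mul, mul_sub, scal_actOn, scal_twist, neg_mul, mul_neg]
      abel
    · grind [Apart, neg_ne_self_and_neg_neg]

end IsCentralExtension

end Lift

/-! ### Independence of the auxiliary index, long elements, and the splitting. -/

section Lift

open SignedIndex OddFormParameter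

variable {R : Type u} [Ring R] {J : PseudoInvolution R}
  {V : Type v} [AddCommGroup V] [Module Rᵐᵒᵖ V] {B : AntiHermitianForm J V}
  {L : OddFormParameter B} {H : Type w} [Group H] {ε : H →* StU 4 L}

namespace IsCentralExtension

/-- Transfer both sides to one `k` unrelated to `i`, `j`, `l`. The result and the correction factor
depend on `k` but not on `j` or `l`, so they cancel. -/
theorem shortLiftVia_one_eq (hε : IsCentralExtension ε) (hD : ApartRootsCommute ε)
    {i j l : SignedIndex 4} (hij : Apart i j) (hil : Apart i l) (ξ : L.toAddSubgroup) :
    hε.shortLiftVia j i ξ 1 = hε.shortLiftVia l i ξ 1 := by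
  obtain ⟨k, hki, hkj, hkl⟩ := exists_apart i j l
  have h1 := hε.shortLiftVia_transfer hD hij hki.symm hkj.symm ξ 1 1
  have h2 := hε.shortLiftVia_transfer hD hil hki.symm hkl.symm ξ 1 1
  simp only [mul_one] at h1 h2
  exact mul_left_cancel (h1.symm.trans h2)

/-- The standard preimage of `X_i(ξ)`. -/
noncomputable def shortLift (hε : IsCentralExtension ε) (i : SignedIndex 4)
    (ξ : L.toAddSubgroup) : H :=
  hε.shortLiftVia (exists_apart i i i).choose i (twist ξ) 1

theorem map_shortLift (hε : IsCentralExtension ε) (i : SignedIndex 4) (ξ : L.toAddSubgroup) :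
    ε (hε.shortLift i ξ) = StU.short L i ξ := by
  rw [shortLift, hε.map_shortLiftVia _ _ (exists_apart i i i).choose_spec.1, twist_twist,
    actOn_one]

theorem shortLiftVia_one (hε : IsCentralExtension ε) (hD : ApartRootsCommute ε)
    {i j : SignedIndex 4} (hij : Apart i j) (ξ : L.toAddSubgroup) :
    hε.shortLiftVia j i ξ 1 = hε.shortLift i (twist ξ) := by
  rw [shortLift, twist_twist]
  exact hε.shortLiftVia_one_eq hD hij (exists_apart i i i).choose_spec.1.symm ξ

/-- The pairs `(ξ, b)` and `(twist (actOn (twist ξ) b), 1)` describe the same short element.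
Transferring both with `d = 1` gives equal correction terms. -/
theorem shortLiftVia_eq (hε : IsCentralExtension ε) (hD : ApartRootsCommute ε)
    {i j : SignedIndex 4} (hij : Apart i j) (ξ : L.toAddSubgroup) (b : R) :
    hε.shortLiftVia j i ξ b = hε.shortLift i (actOn (twist ξ) b) := by
  obtain ⟨k, hki, hkj, -⟩ := exists_apart i j j
  have h1 := hε.shortLiftVia_transfer hD hij hki.symm hkj.symm ξ b 1
  have h2 := hε.shortLiftVia_transfer hD hij hki.symm hkj.symm
    (twist (actOn (twist ξ) b)) 1 1
  rw [hε.shortLiftVia_one hD hki.symm.neg_right] at h1 h2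
  simp only [mul_one] at h1 h2
  rw [actOn_one, twist_twist, hε.shortLiftVia_one hD hij, twist_twist] at h2
  exact mul_left_cancel (h1.symm.trans h2)

/-- The lift of the relation `[X_i(u, a), X_{-i,j}(b)] = X_{ij}(ε_i a b) X_{-j}((u, -ā) ↼ b)`. -/
theorem commutator_short_root (hε : IsCentralExtension ε) (hD : ApartRootsCommute ε)
    {i j : SignedIndex 4} (hij : Apart i j) {ξ : L.toAddSubgroup} {b : R} {x y : H}
    (hx : ε x = StU.short L i ξ) (hy : ε y = StU.root L (-i) j b) :
    ⁅x, y⁆ = hε.rootLift i j (eps J i * (ξ.1.scal * b)) *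
      hε.shortLift (-j) (actOn (twist ξ) b) := by
  have h := hε.commutator_section_rootLift i (-j) ξ b
  rw [neg_neg, hε.shortLiftVia_eq hD hij.symm.neg_left] at h
  rw [← h]
  exact hε.commutatorElement_congr (by rw [hx, map_section])
    (by rw [hy, hε.map_rootLift _ hij.neg_left])

theorem shortLift_mul_shortLift (hε : IsCentralExtension ε) (hD : ApartRootsCommute ε)
    (i : SignedIndex 4) (ξ ζ : L.toAddSubgroup) :
    hε.shortLift i ξ * hε.shortLift i ζ = hε.shortLift i (ξ + ζ) := by
  obtain ⟨j, hji, -, -⟩ := exists_apart i i i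
  -- The factors are taken in the opposite order since `twist` is an anti-homomorphism.
  have hx := hε.map_shortLift j (twist ζ)
  have hz := hε.map_shortLift j (twist ξ)
  have hy := hε.map_rootLift (1 : R) (i := -j) (j := -i)
  have hxz : ε (hε.shortLift j (twist ζ) * hε.shortLift j (twist ξ)) =
      StU.short L j (twist (ξ + ζ)) := by
    rw [map_mul, hx, hz, StU.short_mul_short, twist_add]
  have key := hε.commutator_short_root hD hji.neg_right hxz hy
  rw [commutatorElement_mul_left, hε.commutator_short_root hD hji.neg_right hx hy,
    hε.commutator_short_root hD hji.neg_right hz hy] at key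
  simp only [neg_neg, actOn_one, twist_twist, mul_one] at key
  have ha := hε.map_rootLift (eps J j * (twist ξ).1.scal) (i := j) (j := -i)
  have hb := hε.map_rootLift (eps J j * (twist ζ).1.scal) (i := j) (j := -i)
  have hs := hε.map_shortLift i ξ
  have hx2 := semiconjBy_commutatorElement (hε.shortLift j (twist ζ)) (hε.shortLift i ξ)
  rw [hε.commutator_short_short hD hx hs] at hx2
  have h2 := (SemiconjBy.mul_right (hε.commute_short_root hx ha) hx2).eq
  rw [h2, mul_inv_cancel_right, mul_assoc, mul_assoc, ← mul_assoc (hε.shortLift i ξ),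
    (hε.commute_short_root hs hb).eq, mul_assoc, ← mul_assoc, ← mul_assoc,
    hε.rootLift_mul_rootLift hD hji.neg_right, hε.rootLift_mul_rootLift hD hji.neg_right,
    ← mul_add, ← mul_add] at key
  refine mul_left_cancel (key.trans ?_)
  congr 3
  rw [twist_add, scal_coe_add]
  simp only [vec_twist]
  abel

theorem shortLift_zero (hε : IsCentralExtension ε) (hD : ApartRootsCommute ε)
    (i : SignedIndex 4) : hε.shortLift i (0 : L.toAddSubgroup) = 1 := by
  simpa using hε.shortLift_mul_shortLift hD i 0 0

theorem shortLift_inv (hε : IsCentralExtension ε) (hD : ApartRootsCommute ε)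
    (i : SignedIndex 4) (ξ : L.toAddSubgroup) :
    (hε.shortLift i ξ)⁻¹ = hε.shortLift i (-ξ) := by
  rw [inv_eq_iff_mul_eq_one, hε.shortLift_mul_shortLift hD, add_neg_cancel, hε.shortLift_zero hD]

/-- Hall–Witt again. The double commutator now lies over a short element `X_i(ξ)`, whose commutation
with the roots involved is unconditional. -/
theorem commutator_rootLift_neg_assoc (hε : IsCentralExtension ε) (hD : ApartRootsCommute ε)
    {i j k : SignedIndex 4} (hij : Apart i j) (hik : Apart i k) (hjk : Apart j k) (a b c : R) :
    ⁅hε.rootLift i j (a * b), hε.rootLift j (-i) c⁆ =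
      ⁅hε.rootLift i k a, hε.rootLift k (-i) (b * c)⁆ := by
  have hx := hε.map_rootLift a hik
  have hy := hε.map_rootLift b hjk.symm
  have hz := hε.map_rootLift c hij.symm.neg_right
  have hxy := hε.commutator_root_root hD hx hy
  have hyz := hε.commutator_root_root hD hy hz
  have hw := hε.map_rootLift (b * c) hik.symm.neg_right
  have hv := hε.map_rootLift (a * b) hij
  obtain ⟨ξ, hξ⟩ := StU.exists_commutator_root_root_neg (L := L) hik a (b * c)
  rw [← hx, ← hw, ← map_commutatorElement] at hξ
  rw [← hyz, ← hxy]
  refine commutator_commutator_assoc (hε.commute_root_root hD hx hz) ?_ ?_ ?_ ?_ ?_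
  all_goals simp only [hyz, hxy]
  · exact hε.commute_root_root hD hw hy
  · exact hε.commute_root_root hD hw hz
  · exact (hε.commute_short_root hξ hz).symm
  · exact (hε.commute_short_root hξ hv).symm
  · exact (hε.commute_short_root hξ hy).symm

theorem commutator_rootLift_neg_eq (hε : IsCentralExtension ε) (hD : ApartRootsCommute ε)
    {i j k : SignedIndex 4} (hij : Apart i j) (hik : Apart i k) (a b : R) :
    ⁅hε.rootLift i j a, hε.rootLift j (-i) b⁆ =
      ⁅hε.rootLift i k (a * b), hε.rootLift k (-i) 1⁆ := by
  have key : ∀ {p q : SignedIndex 4}, Apart i p → Apart i q → Apart p q →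
      ∀ c d : R, ⁅hε.rootLift i p c, hε.rootLift p (-i) d⁆ =
        ⁅hε.rootLift i q (c * d), hε.rootLift q (-i) 1⁆ := fun hp hq hpq c d => by
    have h := hε.commutator_rootLift_neg_assoc hD hq hp hpq.symm c d 1
    rwa [mul_one, eq_comm] at h
  obtain ⟨l, hli, hlj, hlk⟩ := exists_apart i j k
  rw [key hij hli.symm hlj.symm, key hli.symm hik hlk, mul_one]

/-- With `x`, `y`, `z` over `X_{jk}(ε_j r)`, `X_{k,-j}(1)`, `X_{-j,-i}(1)`, the double commutator
`⁅⁅x, y⁆, z⁆` is computed both from the short–root relation, as `⁅x, y⁆` lies over `X_j(0, r + r̄)`,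
and by conjugating `z` letter by letter. -/
theorem shortLift_long (hε : IsCentralExtension ε) (hD : ApartRootsCommute ε)
    {i j k : SignedIndex 4} (hij : Apart i j) (hik : Apart i k) (hjk : Apart j k) (r : R) :
    hε.shortLift i (long L r) = ⁅hε.rootLift i k (eps J i * r), hε.rootLift k (-i) 1⁆ := by
  have hx := hε.map_rootLift (eps J j * r) hjk
  have hx' : ε (hε.rootLift j k (eps J j * r)) = StU.root L (-k) (-j) (eps J (-k) * J.bar r) := by
    rw [hx, StU.root_eps_mul hjk]
  have hxi' : ε (hε.rootLift j k (eps J j * r))⁻¹ =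
      StU.root L (-k) (-j) (-(eps J (-k) * J.bar r)) := by
    rw [map_inv, hx', StU.root_inv hjk.symm.neg_left.neg_right]
  have hxi : ε (hε.rootLift j k (eps J j * r))⁻¹ = StU.root L j k (-(eps J j * r)) := by
    rw [map_inv, hx, StU.root_inv hjk]
  have hy := hε.map_rootLift (1 : R) hjk.symm.neg_right
  have hyi : ε (hε.rootLift k (-j) 1)⁻¹ = StU.root L k (-j) (-1) := by
    rw [map_inv, hy, StU.root_inv hjk.symm.neg_right]
  have hy' : ε (hε.rootLift k (-j) 1) = StU.root L j (-k) (eps J j * J.bar 1 * eps J k) := by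
    rw [hy, StU.root_neg_neg hjk.symm.neg_right, neg_neg]
  have hz := hε.map_rootLift (1 : R) hij.symm.neg_left.neg_right
  have hxy : ε ⁅hε.rootLift j k (eps J j * r), hε.rootLift k (-j) 1⁆ =
      StU.short L j (long L r) := by
    rw [map_commutatorElement, hx, hy, StU.commutator_root_root_neg hjk]
  have main := hε.commutator_short_root hD hij.symm.neg_right hxy hz
  have hA := hε.map_rootLift (eps J j * r) hij.symm.neg_right
  have hA' := hε.map_rootLift (eps J j * J.bar r) hij.symm.neg_right
  have hN := hε.map_rootLift (-(eps J (-k) * J.bar r)) hik.symm.neg_left.neg_right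
  have hP := hε.map_rootLift (-1 : R) hik.symm.neg_right
  set x := hε.rootLift j k (eps J j * r)
  set y := hε.rootLift k (-j) 1
  set z := hε.rootLift (-j) (-i) 1
  -- The conjugations by `y⁻¹`, `x⁻¹`, `y`, `x` take `z` through `P z`, `A P N z` and `A A' ⁅P, N⁆ N
  -- z` to `A A' ⁅P, N⁆ z`.
  have s1 := hε.semiconjBy_root_root hD hyi hz
  have s2 := hε.semiconjBy_root_root hD hxi hP
  have s3 := hε.semiconjBy_root_root hD hxi' hz
  have s4 := hε.semiconjBy_root_root hD hy' hN
  have s5 := hε.semiconjBy_root_root hD hy hz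
  have s6 := hε.semiconjBy_root_root hD hx' hz
  have e4 : eps J j * J.bar 1 * eps J k * -(eps J (-k) * J.bar r) = eps J j * J.bar r := by
    simp only [mul_assoc, mul_neg, J.mul_eps_mul_eps_neg_mul, neg_neg]
  rw [e4] at s4
  simp only [mul_one, mul_neg, neg_neg] at s1 s2 s3 s4 s5 s6
  set A := hε.rootLift j (-i) (eps J j * r)
  set A' := hε.rootLift j (-i) (eps J j * J.bar r)
  have hN' : hε.rootLift (-k) (-i) (eps J (-k) * J.bar r) =
      (hε.rootLift (-k) (-i) (-(eps J (-k) * J.bar r)))⁻¹ := by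
    rw [hε.rootLift_inv hD hik.symm.neg_left.neg_right, neg_neg]
  have hP' : hε.rootLift k (-i) 1 = (hε.rootLift k (-i) (-1))⁻¹ := by
    rw [hε.rootLift_inv hD hik.symm.neg_right, neg_neg]
  rw [hN'] at s6
  rw [hP'] at s5
  set N := hε.rootLift (-k) (-i) (-(eps J (-k) * J.bar r)) with hNdef
  set P := hε.rootLift k (-i) (-1)
  have t2 : SemiconjBy x⁻¹ (P * z) (A * P * (N * z)) := s2.mul_right s3
  have t3 : SemiconjBy y (A * P * (N * z)) (A * P * (A' * N * (P⁻¹ * z))) :=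
    (SemiconjBy.mul_right (hε.commute_root_root hD hy hA)
      (hε.commute_root_root hD hy hP)).mul_right (s4.mul_right s5)
  have hPA' : Commute P A' := hε.commute_root_root hD hP hA'
  have t4 : A * P * (A' * N * (P⁻¹ * z)) = A * A' * ⁅P, N⁆ * (N * z) := by
    rw [mul_assoc A, mul_assoc A' N, ← mul_assoc P, hPA'.eq]
    simp only [commutatorElement_def]; group
  have hPN : ∃ ξ, ε ⁅P, N⁆ = StU.short L i ξ := by
    obtain ⟨ξ, hξ⟩ := StU.exists_commutator_root_root_neg (L := L) hik
      (eps J i * -r) (-1)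
    refine ⟨-ξ, ?_⟩
    rw [← StU.short_inv, ← hξ, ← commutatorElement_inv, map_inv, map_commutatorElement, hP, hN,
      StU.root_eps_mul hik, map_neg, mul_neg]
  obtain ⟨ξ, hξ⟩ := hPN
  have t5 : SemiconjBy x (A * A' * ⁅P, N⁆ * (N * z)) (A * A' * ⁅P, N⁆ * (N * (N⁻¹ * z))) :=
    ((SemiconjBy.mul_right (hε.commute_root_root hD hx hA)
      (hε.commute_root_root hD hx hA')).mul_right (hε.commute_short_root hξ hx).symm).mul_right
        (SemiconjBy.mul_right (hε.commute_root_root hD hx hN) s6)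
  rw [t4] at t3
  rw [mul_inv_cancel_left] at t5
  have t6 := t5.mul_left (t3.mul_left (t2.mul_left s1))
  have t7 : SemiconjBy ⁅x, y⁆ z (A * A' * ⁅P, N⁆ * z) := by
    simpa only [commutatorElement_def, mul_assoc] using t6
  rw [t7.commutatorElement_eq, neg_neg, actOn_one, twist_long, ← hε.shortLift_inv hD,
    hε.rootLift_mul_rootLift hD hij.symm.neg_right, ← mul_add, scal_long, mul_one] at main
  have h8 := mul_left_cancel main
  rw [← inv_inj, inv_inv, commutatorElement_inv, hNdef, ← mul_neg, ← map_neg,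
    ← hε.rootLift_eps_mul hD hik] at h8
  -- The coefficients are `-ε_i r` and `-1`; only their product matters, so the signs cancel.
  rw [← h8, hε.commutator_rootLift_neg_eq hD hik hik, mul_neg_one, mul_neg, neg_neg]

/-- The lift of the relation expressing `[X_{ij}(a), X_{j,-i}(b)]`. -/
theorem commutator_rootLift_neg (hε : IsCentralExtension ε) (hD : ApartRootsCommute ε)
    {i j : SignedIndex 4} (hij : Apart i j) (a b : R) :
    ⁅hε.rootLift i j a, hε.rootLift j (-i) b⁆ = hε.shortLift i
      ⟨⟨0, -(eps J (-i) * J.bar 1 * a * b) + J.bar b * J.lamInv * J.bar a * eps J i⟩,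
        L.long_mem i a b⟩ := by
  obtain ⟨k, hki, hkj, -⟩ := exists_apart i j j
  obtain ⟨r, hr⟩ := J.eps_mul_surjective i (a * b)
  rw [hε.commutator_rootLift_neg_eq hD hij hij, hr, ← hε.shortLift_long hD hki.symm hij hkj]
  refine congrArg _ (ext_coe rfl ?_)
  change r + J.bar r = -(eps J (-i) * J.bar 1 * a * b) + J.bar b * J.lamInv * J.bar a * eps J i
  rw [mul_assoc _ a, hr, J.eps_neg_mul_mul_eps, neg_neg, mul_assoc (J.bar b),
    ← J.bar_mul', hr, J.bar_eps_mul]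

/-- A central extension in which preimages of root elements with unrelated indices commute
is split. -/
theorem exists_section (hε : IsCentralExtension ε) (hD : ApartRootsCommute ε) :
    ∃ s : StU 4 L →* H, ∀ g, ε (s g) = g := by
  let f : StUGen 4 L → H
    | .root i j _ a => hε.rootLift i j a
    | .short i ξ => hε.shortLift i ξ
  have hY : ∀ i j (h : Apart i j) a, FreeGroup.lift f (StUGen.Y L i j h a) = hε.rootLift i j a :=
    fun i j h a => FreeGroup.lift_apply_of
  have hZ : ∀ i ξ, FreeGroup.lift f (StUGen.Z i ξ) = hε.shortLift i ξ :=
    fun i ξ => FreeGroup.lift_apply_of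
  have hrel : ∀ p q, StUGen.Rel L p q → FreeGroup.lift f p = FreeGroup.lift f q := by
    intro p q hpq
    cases hpq <;> simp only [map_commutatorElement, map_mul, map_one, hY, hZ]
    case r0 i j h a => exact hε.rootLift_neg_neg hD h a
    case r1 i j h a b => exact hε.rootLift_mul_rootLift hD h a b
    case r2 i ξ ζ => exact hε.shortLift_mul_shortLift hD i ξ ζ
    case r3 i j h k hij hhk h1 h2 h3 h4 a b =>
      exact commutatorElement_eq_one_iff_commute.2
        (hε.commute_rootLift_rootLift hD a b ⟨hij, hhk, h1, h2, h3, h4⟩)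
    case r4 i j k hjk h1 h2 ξ a =>
      exact commutatorElement_eq_one_iff_commute.2
        (hε.commute_short_root (hε.map_shortLift i ξ) (hε.map_rootLift a hjk) ⟨hjk, h1, h2⟩)
    case r5 i j k hij hjk hik a b =>
      exact hε.commutator_root_root hD (hε.map_rootLift a hij) (hε.map_rootLift b hjk)
        ⟨hik, hij, hjk.symm⟩
    case r6 i j h ξ ζ =>
      exact hε.commutator_short_short hD (hε.map_shortLift i ξ) (hε.map_shortLift j ζ) h
    case r7 i ξ ζ =>
      -- This relation is a consequence of additivity: it is the commutator formula in the
      -- Heisenberg group.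
      rw [commutatorElement_def, mul_inv_eq_iff_eq_mul, mul_inv_eq_iff_eq_mul]
      simp only [hε.shortLift_mul_shortLift hD]
      refine congrArg _ (ext_coe ?_ ?_)
      · simp [add_comm]
      · simp; abel
    case r8 i j h ξ b =>
      rw [mul_assoc (eps J i)]
      exact hε.commutator_short_root hD h (hε.map_shortLift i ξ) (hε.map_rootLift b h.neg_left)
    case r9 i j h a b => exact hε.commutator_rootLift_neg hD h a b
  let s : StU 4 L →* H := PresentedGroup.toGroup (f := f) (by
    rintro _ ⟨p, q, hpq, rfl⟩
    rw [map_mul, map_inv, hrel p q hpq, mul_inv_cancel])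
  refine ⟨s, fun g => ?_⟩
  have hs : ε.comp s = MonoidHom.id _ := by
    refine PresentedGroup.ext fun t => ?_
    rw [MonoidHom.comp_apply, PresentedGroup.toGroup.of]
    cases t with
    | root i j h a => exact (hε.map_rootLift a h).trans (StU.root_eq h a)
    | short i ξ => exact hε.map_shortLift i ξ
  exact DFunLike.congr_fun hs g

end IsCentralExtension

end Lift

/-! ### Universal central extensions -/

/-- Over the central extension `U × Abelianization U`, both the abelianization map and the trivial
map give a lift of `π`; uniqueness makes them equal. -/
theorem IsUniversalCentralExtension.commutator_eq_top {U : Type w} {G : Type*} [Group U] [Group G]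
    {π : U →* G} (hπ : IsUniversalCentralExtension π) : commutator U = ⊤ := by
  let p : U × Abelianization U →* G := π.comp (MonoidHom.fst U (Abelianization U))
  have hp : IsCentralExtension p := by
    refine ⟨fun g => ?_, fun t ht => Subgroup.mem_center_iff.2 fun t' => ?_⟩
    · obtain ⟨x, rfl⟩ := hπ.surjective g
      exact ⟨(x, 1), rfl⟩
    · exact Prod.ext (Subgroup.mem_center_iff.1 (hπ.ker_le_center (x := t.1) ht) t'.1)
        (mul_comm _ _)
  have h := (hπ.existsUnique_lift _ p hp).unique
    (y₁ := (MonoidHom.id U).prod Abelianization.of) (y₂ := (MonoidHom.id U).prod 1) rfl rfl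
  rw [eq_top_iff, ← Abelianization.ker_of]
  intro x _
  exact congrArg Prod.snd (DFunLike.congr_fun h x)

theorem theorem2 {R : Type u} [Ring R] {J : PseudoInvolution R}
    {V : Type v} [AddCommGroup V] [Module Rᵐᵒᵖ V] {B : AntiHermitianForm J V}
    (L : OddFormParameter B)
    {U : Type w} [Group U] (π : U →* StU 4 L) (hπ : IsUniversalCentralExtension π) :
    schurMultiplier π hπ =
      Subgroup.closure {c : U | ∃ (i j k h : SignedIndex 4)
        (hij : SignedIndex.Apart i j) (hkh : SignedIndex.Apart k h) (a b : R) (x y : U),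
        ({i, -i, j, -j, k, -k, h, -h} : Finset (SignedIndex 4)).card = 8 ∧
        π x = StU.X L i j hij a ∧ π y = StU.X L k h hkh b ∧ c = ⁅x, y⁆} := by
  set C := Subgroup.closure {c : U | ∃ (i j k h : SignedIndex 4)
        (hij : SignedIndex.Apart i j) (hkh : SignedIndex.Apart k h) (a b : R) (x y : U),
        ({i, -i, j, -j, k, -k, h, -h} : Finset (SignedIndex 4)).card = 8 ∧
        π x = StU.X L i j hij a ∧ π y = StU.X L k h hkh b ∧ c = ⁅x, y⁆} with hC
  have hle : C ≤ π.ker := by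
    rw [hC, Subgroup.closure_le]
    rintro _ ⟨i, j, k, h, hij, hkh, a, b, x, y, hcard, hx, hy, rfl⟩
    rw [SetLike.mem_coe, MonoidHom.mem_ker, map_commutatorElement, hx, hy, ← StU.root_eq,
      ← StU.root_eq]
    exact commutatorElement_eq_one_iff_commute.2
      (StU.commute_root_root (SignedIndex.rootsCommute_of_card hij hkh hcard) a b)
  refine le_antisymm ?_ hle
  have hCn : C.Normal := ⟨fun c hc g => by
    rw [Subgroup.mem_center_iff.1 (hπ.ker_le_center (hle hc)) g, mul_inv_cancel_right]
    exact hc⟩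
  let ε : U ⧸ C →* StU 4 L := QuotientGroup.lift C π hle
  have hεmk : ∀ x : U, ε x = π x := fun x => rfl
  have hε : IsCentralExtension ε := by
    refine ⟨fun g => ?_, fun t ht => Subgroup.mem_center_iff.2 fun t' => ?_⟩
    · obtain ⟨x, rfl⟩ := hπ.surjective g
      exact ⟨x, rfl⟩
    · induction t using QuotientGroup.induction_on with | _ x => ?_
      induction t' using QuotientGroup.induction_on with | _ y => ?_
      exact congrArg (QuotientGroup.mk' C)
        (Subgroup.mem_center_iff.1 (hπ.ker_le_center (x := x) ht) y)
  have hD : ApartRootsCommute ε := by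
    intro i j k h h1 h2 h3 h4 h5 h6 a b t t' ht ht'
    induction t using QuotientGroup.induction_on with | _ x => ?_
    induction t' using QuotientGroup.induction_on with | _ y => ?_
    rw [← commutatorElement_eq_one_iff_commute]
    refine (QuotientGroup.eq_one_iff (N := C) ⁅x, y⁆).2 (Subgroup.subset_closure ?_)
    rw [hεmk, StU.root_eq h1] at ht
    rw [hεmk, StU.root_eq h6] at ht'
    exact ⟨i, j, k, h, h1, h6, a, b, x, y, SignedIndex.card_eq_eight h1 h2 h3 h4 h5 h6, ht, ht', rfl⟩
  obtain ⟨s, hs⟩ := hε.exists_section hD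
  -- A commutator in `U ⧸ C` is unchanged when each entry `t` is replaced by `s (ε t)`, so it lies
  -- in the range of `s`; perfectness of `U` then makes `s` surjective.
  have hrange : commutator U ≤ s.range.comap (QuotientGroup.mk' C) := by
    rw [commutator_def, Subgroup.commutator_le]
    intro x _ y _
    rw [Subgroup.mem_comap, map_commutatorElement,
      hε.commutatorElement_congr (hs _).symm (hs _).symm, ← map_commutatorElement]
    exact ⟨_, rfl⟩
  rw [hπ.commutator_eq_top] at hrange
  intro x hx
  obtain ⟨g, hg⟩ := hrange (Subgroup.mem_top x)
  have hg1 : g = 1 := by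
    rw [← hs g, hg]
    exact hx
  rw [hg1, map_one] at hg
  exact (QuotientGroup.eq_one_iff (N := C) x).1 hg.symm
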